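/- **Theorem (modified and iterated modified Galerkin rates).** Let $r\ge 0$ be an integer and let $\kappa:[0,1]^2\to\mathbb R$ be a Green's kernel: $\kappa=\kappa_1$ on $\{0\le t\le s\le 1\}$ and $\kappa=\kappa_2$ on $\{0\le s\le t\le 1\}$, where $\kappa_1,\kappa_2$ are real functions of class $C^{\alpha}$ on the respective closed triangles for some integer $\alpha\ge 2r+2$, and $\kappa_1(s,s)=\kappa_2(s,s)$ for all $s\in[0,1]$. On the complex space $L^\infty[0,1]$ with the norm $\|\cdot\|_\infty$ let $$(\mathcal K x)(s)=\int_0^1\kappa(s,t)\,x(t)\,dt .$$ For $n\ge 1$ put $h=1/n$, let $\mathcal X_n$ be the space of functions that are a polynomial of degree at most $2r$ on each of the intervals $((j-1)h,jh]$, $j=1,\dots,n$ (no continuity at the nodes is required), let $P_n:L^\infty[0,1]\to\mathcal X_n$ be the restriction to $L^\infty[0,1]$ of the $L^2$-orthogonal projection onto $\mathcal X_n$, and let $$\mathcal K_n^M=P_n\mathcal K+\mathcal K P_n-P_n\mathcal K P_n .$$ Let $\lambda\ne 0$ be a simple eigenvalue of $\mathcal K$. Let $\Gamma$ be a positively oriented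 circle centred at $\lambda$ such that the closed disc bounded by $\Gamma$ contains no point of the spectrum of $\mathcal K$ other than $\lambda$, and let $$E=-\frac1{2\pi i}\int_\Gamma(\mathcal K-zI)^{-1}\,dz,\qquad E_n^M=-\frac1{2\pi i}\int_\Gamma(\mathcal K_n^M-zI)^{-1}\,dz$$ be the spectral projections; that $\lambda$ is simple means that the range $\mathcal R(E)$ is one-dimensional. Then there are a constant $C$ and an integer $N\ge1$, independent of $n$, such that the following holds for every $n\ge N$. The circle $\Gamma$ lies in the resolvent set of $\mathcal K_n^M$, the range $\mathcal R(E_n^M)$ is one-dimensional, and $\mathcal K_n^M$ has exactly one spectral value $\lambda_n^M$ inside $\Gamma$; it is nonzero, and $$|\lambda-\lambda_n^M|\le\begin{cases}C\,h^{2r+5}& \text{if } r\ge1,\\ C\,h^{4}&\text{if } r=0.\end{cases}$$ Moreover every $\varphi_n^M\in\mathcal R(E_n^M)$ with $\|\varphi_n^M\|_\infty=1$ satisfies $\mathcal K_n^M\varphi_n^M=\lambda_n^M\varphi_n^M$ and, with the iterated vector $\widetilde\varphi_n^M=\frac1{\lambda_n^M}\mathcal K\varphi_n^M$, $$\|\varphi_n^M-E\varphi_n^M\|_\infty\le\begin{cases}C\,h^{2r+3}&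 \text{if } r\ge1,\\ C\,h^{3}&\text{if } r=0,\end{cases}\qquad \|\widetilde\varphi_n^M-E\widetilde\varphi_n^M\|_\infty\le\begin{cases}C\,h^{2r+5}& \text{if } r\ge1,\\ C\,h^{4}&\text{if } r=0.\end{cases}$$ -/

import Mathlib

open MeasureTheory Set

open scoped ENNReal

noncomputable section

namespace GreenGalerkin

/-! ### The space `L^∞[0,1]` -/

/-- Lebesgue measure on `[0,1]`. -/
abbrev unitMeasure : Measure ℝ := volume.restrict (Icc (0 : ℝ) 1)

instance : IsProbabilityMeasure unitMeasure :=
  ⟨by simp [unitMeasure]⟩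

/-- The complex Banach space `L^∞[0,1]`, with the (essential) supremum norm. -/
abbrev LInf : Type := Lp ℂ ∞ unitMeasure

/-- The complex Hilbert space `L²[0,1]`. -/
abbrev LTwo : Type := Lp ℂ 2 unitMeasure

lemma ae_norm_le (x : LInf) : ∀ᵐ t ∂unitMeasure, ‖x t‖ ≤ ‖x‖ := by
  have h := ae_le_eLpNormEssSup (f := (x : ℝ → ℂ)) (μ := unitMeasure)
  filter_upwards [h] with t ht
  rw [Lp.norm_def, eLpNorm_exponent_top, ← toReal_enorm]
  refine ENNReal.toReal_mono ?_ ht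
  rw [← eLpNorm_exponent_top]
  exact Lp.eLpNorm_ne_top x

/-! ### Green's kernels and the integral operator -/

/-- The closed triangle `0 ≤ t ≤ s ≤ 1`. -/
def lowerTriangle : Set (ℝ × ℝ) := {p | 0 ≤ p.2 ∧ p.2 ≤ p.1 ∧ p.1 ≤ 1}

/-- The closed triangle `0 ≤ s ≤ t ≤ 1`. -/
def upperTriangle : Set (ℝ × ℝ) := {p | 0 ≤ p.1 ∧ p.1 ≤ p.2 ∧ p.2 ≤ 1}

/-- A real Green's kernel of smoothness `α`: two functions, of class `C^α` on the closed triangles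
`t ≤ s` and `s ≤ t` of the unit square respectively, that agree on the diagonal. -/
structure GreenKernel (α : ℕ) where
  /-- the branch used for `t ≤ s` -/
  lower : ℝ → ℝ → ℝ
  /-- the branch used for `s ≤ t` -/
  upper : ℝ → ℝ → ℝ
  contDiffOn_lower : ContDiffOn ℝ α (fun p : ℝ × ℝ => lower p.1 p.2) lowerTriangle
  contDiffOn_upper : ContDiffOn ℝ α (fun p : ℝ × ℝ => upper p.1 p.2) upperTriangle
  diag : ∀ s ∈ Icc (0 : ℝ) 1, lower s s = upper s s

namespace GreenKernel

variable {α : ℕ} (κ : GreenKernel α)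

/-- The kernel `κ(s,t)` itself. -/
def kernel (s t : ℝ) : ℝ := if t ≤ s then κ.lower s t else κ.upper s t

lemma continuousOn_kernel :
    ContinuousOn (fun p : ℝ × ℝ => κ.kernel p.1 p.2) (Icc (0 : ℝ) 1 ×ˢ Icc (0 : ℝ) 1) := by
  have hL : IsClosed lowerTriangle := by
    have : lowerTriangle = {p : ℝ × ℝ | 0 ≤ p.2} ∩ ({p | p.2 ≤ p.1} ∩ {p | p.1 ≤ 1}) := rfl
    rw [this]
    exact (isClosed_le (by fun_prop) (by fun_prop)).inter
      ((isClosed_le (by fun_prop) (by fun_prop)).inter (isClosed_le (by fun_prop) (by fun_prop)))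
  have hU : IsClosed upperTriangle := by
    have : upperTriangle = {p : ℝ × ℝ | 0 ≤ p.1} ∩ ({p | p.1 ≤ p.2} ∩ {p | p.2 ≤ 1}) := rfl
    rw [this]
    exact (isClosed_le (by fun_prop) (by fun_prop)).inter
      ((isClosed_le (by fun_prop) (by fun_prop)).inter (isClosed_le (by fun_prop) (by fun_prop)))
  have h1 : ContinuousOn (fun p : ℝ × ℝ => κ.kernel p.1 p.2) lowerTriangle := by
    refine κ.contDiffOn_lower.continuousOn.congr ?_
    rintro ⟨s, t⟩ ⟨_, h, _⟩
    simp only at h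
    simp [kernel, h]
  have h2 : ContinuousOn (fun p : ℝ × ℝ => κ.kernel p.1 p.2) upperTriangle := by
    refine κ.contDiffOn_upper.continuousOn.congr ?_
    rintro ⟨s, t⟩ ⟨h0, h, h'⟩
    simp only at h0 h h'
    rcases h.lt_or_eq with h | rfl
    · simp [kernel, not_le.mpr h]
    · simp [kernel, κ.diag s ⟨h0, h'⟩]
  refine (h1.union_of_isClosed h2 hL hU).mono ?_
  rintro ⟨s, t⟩ ⟨⟨hs0, hs1⟩, ⟨ht0, ht1⟩⟩
  rcases le_total t s with h | h
  · exact Or.inl ⟨ht0, h, hs1⟩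
  · exact Or.inr ⟨hs0, h, ht1⟩

lemma exists_bound : ∃ M : ℝ, 0 ≤ M ∧
    ∀ s ∈ Icc (0 : ℝ) 1, ∀ t ∈ Icc (0 : ℝ) 1, |κ.kernel s t| ≤ M := by
  obtain ⟨M, hM⟩ := (isCompact_Icc.prod isCompact_Icc).exists_bound_of_continuousOn
    κ.continuousOn_kernel
  refine ⟨max M 0, le_max_right _ _, fun s hs t ht => ?_⟩
  exact (hM (s, t) ⟨hs, ht⟩).trans (le_max_left _ _)

/-- A bound for `|κ|` on the unit square. -/
def bound : ℝ := κ.exists_bound.choose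

lemma bound_nonneg : 0 ≤ κ.bound := κ.exists_bound.choose_spec.1

lemma abs_kernel_le {s t : ℝ} (hs : s ∈ Icc (0 : ℝ) 1) (ht : t ∈ Icc (0 : ℝ) 1) :
    |κ.kernel s t| ≤ κ.bound := κ.exists_bound.choose_spec.2 s hs t ht

/-- The function `s ↦ ∫₀¹ κ(s,t) x(t) dt`. -/
def integralFun (x : LInf) (s : ℝ) : ℂ := ∫ t, (κ.kernel s t : ℂ) * x t ∂unitMeasure

lemma aestronglyMeasurable_kernel :
    AEStronglyMeasurable (fun p : ℝ × ℝ => (κ.kernel p.1 p.2 : ℂ))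
      (unitMeasure.prod unitMeasure) := by
  rw [Measure.prod_restrict]
  exact (Complex.continuous_ofReal.comp_continuousOn κ.continuousOn_kernel).aestronglyMeasurable
    (measurableSet_Icc.prod measurableSet_Icc)

lemma ae_norm_integrand_le (x : LInf) {s : ℝ} (hs : s ∈ Icc (0 : ℝ) 1) :
    ∀ᵐ t ∂unitMeasure, ‖(κ.kernel s t : ℂ) * x t‖ ≤ κ.bound * ‖x‖ := by
  filter_upwards [ae_norm_le x, ae_restrict_mem measurableSet_Icc] with t ht htm
  rw [norm_mul, Complex.norm_real, Real.norm_eq_abs]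
  exact mul_le_mul (κ.abs_kernel_le hs htm) ht (norm_nonneg _) κ.bound_nonneg

lemma integrable_integrand (x : LInf) {s : ℝ} (hs : s ∈ Icc (0 : ℝ) 1) :
    Integrable (fun t => (κ.kernel s t : ℂ) * x t) unitMeasure := by
  refine Integrable.of_bound ?_ (κ.bound * ‖x‖) (κ.ae_norm_integrand_le x hs)
  refine AEStronglyMeasurable.mul ?_ (Lp.aestronglyMeasurable x)
  have h : ContinuousOn (fun t => (κ.kernel s t : ℂ)) (Icc (0 : ℝ) 1) := by
    refine Complex.continuous_ofReal.comp_continuousOn ?_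
    exact κ.continuousOn_kernel.comp (f := fun t : ℝ => (s, t)) (by fun_prop)
      (fun t ht => ⟨hs, ht⟩)
  exact h.aestronglyMeasurable measurableSet_Icc

lemma norm_integralFun_le (x : LInf) {s : ℝ} (hs : s ∈ Icc (0 : ℝ) 1) :
    ‖κ.integralFun x s‖ ≤ κ.bound * ‖x‖ := by
  have h := norm_integral_le_of_norm_le_const (κ.ae_norm_integrand_le x hs)
  simpa [integralFun] using h

lemma aestronglyMeasurable_integralFun (x : LInf) :
    AEStronglyMeasurable (κ.integralFun x) unitMeasure := by
  have h : AEStronglyMeasurable (fun p : ℝ × ℝ => (κ.kernel p.1 p.2 : ℂ) * x p.2)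
      (unitMeasure.prod unitMeasure) :=
    κ.aestronglyMeasurable_kernel.mul (Lp.aestronglyMeasurable x).comp_snd
  exact h.integral_prod_right'

lemma memLp_integralFun (x : LInf) : MemLp (κ.integralFun x) ∞ unitMeasure := by
  refine memLp_top_of_bound (κ.aestronglyMeasurable_integralFun x) (κ.bound * ‖x‖) ?_
  filter_upwards [ae_restrict_mem measurableSet_Icc] with s hs
  exact κ.norm_integralFun_le x hs

/-- The integral operator `(𝒦x)(s) = ∫₀¹ κ(s,t) x(t) dt` on `L^∞[0,1]`. -/
def integralOperator : LInf →L[ℂ] LInf :=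
  LinearMap.mkContinuous
    { toFun := fun x => (κ.memLp_integralFun x).toLp (κ.integralFun x)
      map_add' := fun x y => by
        rw [← MemLp.toLp_add, MemLp.toLp_eq_toLp_iff]
        filter_upwards [ae_restrict_mem measurableSet_Icc] with s hs
        simp only [Pi.add_apply, integralFun]
        rw [← integral_add (κ.integrable_integrand x hs) (κ.integrable_integrand y hs)]
        refine integral_congr_ae ?_
        filter_upwards [Lp.coeFn_add x y] with t ht
        simp only [ht, Pi.add_apply, mul_add]
      map_smul' := fun c x => by
        rw [RingHom.id_apply, ← MemLp.toLp_const_smul, MemLp.toLp_eq_toLp_iff]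
        filter_upwards [ae_restrict_mem measurableSet_Icc] with s hs
        simp only [Pi.smul_apply, integralFun]
        rw [← integral_smul]
        refine integral_congr_ae ?_
        filter_upwards [Lp.coeFn_smul c x] with t ht
        simp only [ht, Pi.smul_apply, smul_eq_mul]
        ring }
    κ.bound
    (fun x => by
      have h := Lp.norm_le_of_ae_bound (f := (κ.memLp_integralFun x).toLp (κ.integralFun x))
        (mul_nonneg κ.bound_nonneg (norm_nonneg x)) (by
          filter_upwards [(κ.memLp_integralFun x).coeFn_toLp,
            ae_restrict_mem measurableSet_Icc] with s h hs
          rw [h]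
          exact κ.norm_integralFun_le x hs)
      simpa using h)

end GreenKernel

/-! ### Piecewise polynomials and the orthogonal projection -/

lemma memLp_cellMonomial (n j k : ℕ) :
    MemLp ((Ioc ((j : ℝ) / n) ((j + 1 : ℝ) / n)).indicator (fun t : ℝ => (t : ℂ) ^ k))
      ∞ unitMeasure := by
  refine memLp_top_of_bound (μ := unitMeasure) ?_ 1 ?_
  · exact (Continuous.aestronglyMeasurable (by fun_prop)).indicator measurableSet_Ioc
  · filter_upwards [ae_restrict_mem measurableSet_Icc] with t ht
    refine (norm_indicator_le_norm_self _ _).trans ?_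
    rw [norm_pow, Complex.norm_real, Real.norm_eq_abs, abs_of_nonneg ht.1]
    exact pow_le_one₀ ht.1 ht.2

/-- The function equal to `t ^ k` on the cell `(j/n, (j+1)/n]` and to `0` elsewhere. -/
def cellMonomial (n j k : ℕ) : LInf := (memLp_cellMonomial n j k).toLp _

/-- The space `𝒳ₙ` of functions that are, on each of the `n` cells of the uniform partition of
`[0,1]`, a polynomial of degree at most `2 r`; no continuity at the nodes is imposed. -/
def piecewisePoly (r n : ℕ) : Submodule ℂ LInf :=
  Submodule.span ℂ (range fun p : Fin n × Fin (2 * r + 1) => cellMonomial n p.1 p.2)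

instance (r n : ℕ) : FiniteDimensional ℂ (piecewisePoly r n) :=
  FiniteDimensional.span_of_finite ℂ (finite_range _)

/-- The inclusion of `L^∞[0,1]` into `L²[0,1]`. -/
def inclusion : LInf →L[ℂ] LTwo :=
  LinearMap.mkContinuous
    { toFun := fun x => ((Lp.memLp x).mono_exponent le_top).toLp x
      map_add' := fun x y => by
        rw [← MemLp.toLp_add, MemLp.toLp_eq_toLp_iff]
        exact Lp.coeFn_add x y
      map_smul' := fun c x => by
        rw [RingHom.id_apply, ← MemLp.toLp_const_smul, MemLp.toLp_eq_toLp_iff]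
        exact Lp.coeFn_smul c x }
    1
    (fun x => by
      rw [one_mul]
      simp only [LinearMap.coe_mk, AddHom.coe_mk]
      rw [Lp.norm_toLp, Lp.norm_def]
      exact ENNReal.toReal_mono (Lp.eLpNorm_ne_top x)
        (eLpNorm_le_eLpNorm_of_exponent_le le_top (Lp.aestronglyMeasurable x)))

lemma inclusion_injective : Function.Injective inclusion := by
  intro x y h
  have h' := (MemLp.toLp_eq_toLp_iff ((Lp.memLp x).mono_exponent le_top)
    ((Lp.memLp y).mono_exponent le_top)).1 h
  exact Lp.ext h'

/-- `𝒳ₙ` regarded as a subspace of `L²[0,1]`. -/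
def piecewisePolyTwo (r n : ℕ) : Submodule ℂ LTwo :=
  (piecewisePoly r n).map (inclusion : LInf →ₗ[ℂ] LTwo)

instance (r n : ℕ) : FiniteDimensional ℂ (piecewisePolyTwo r n) := by
  unfold piecewisePolyTwo; infer_instance

/-- `𝒳ₙ ⊆ L^∞[0,1]` and `𝒳ₙ ⊆ L²[0,1]` are the same space. -/
def piecewisePolyEquiv (r n : ℕ) : piecewisePoly r n ≃ₗ[ℂ] piecewisePolyTwo r n :=
  Submodule.equivMapOfInjective (inclusion : LInf →ₗ[ℂ] LTwo) inclusion_injective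
    (piecewisePoly r n)

/-- The orthogonal projection `Pₙ : L^∞[0,1] → 𝒳ₙ ⊆ L^∞[0,1]`: the restriction to `L^∞[0,1]` of
the orthogonal projection of `L²[0,1]` onto `𝒳ₙ`. -/
def galerkinProjection (r n : ℕ) : LInf →L[ℂ] LInf :=
  (piecewisePoly r n).subtypeL ∘L
    LinearMap.toContinuousLinearMap
      ((piecewisePolyEquiv r n).symm : piecewisePolyTwo r n →ₗ[ℂ] piecewisePoly r n) ∘L
    (piecewisePolyTwo r n).orthogonalProjectionOnto ∘L inclusion

/-- The modified Galerkin operator `𝒦ₙᴹ = Pₙ𝒦 + 𝒦Pₙ - Pₙ𝒦Pₙ`. -/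
def modifiedOperator {α : ℕ} (κ : GreenKernel α) (r n : ℕ) : LInf →L[ℂ] LInf :=
  galerkinProjection r n ∘L κ.integralOperator + κ.integralOperator ∘L galerkinProjection r n
    - galerkinProjection r n ∘L κ.integralOperator ∘L galerkinProjection r n

/-! ### Spectral projections -/

/-- The spectral projection `-(2πi)⁻¹ ∮_Γ (T - z)⁻¹ dz`, where `Γ` is the positively oriented
circle with centre `c` and radius `ρ`. -/
def spectralProjection (T : LInf →L[ℂ] LInf) (c : ℂ) (ρ : ℝ) : LInf →L[ℂ] LInf :=
  -((2 * Real.pi * Complex.I : ℂ)⁻¹ •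
    ∮ z in C(c, ρ), Ring.inverse (T - z • (1 : LInf →L[ℂ] LInf)))

/-- `c` is an isolated point of the spectrum of `T`, and the circle with centre `c` and radius `ρ`
lies in the resolvent set and separates `c` from the remainder of the spectrum. -/
def Isolates (T : LInf →L[ℂ] LInf) (c : ℂ) (ρ : ℝ) : Prop :=
  0 < ρ ∧ Metric.closedBall c ρ ∩ spectrum ℂ T = {c}

end GreenGalerkin

end

noncomputable section

namespace GreenGalerkin

/-! ### Riesz projections in a Banach algebra -/

/-! Put D = 𝒦 − 𝒦ₙᴹ. Expanding gives D = (I − Pₙ)𝒦(I − Pₙ) (`sub_modifiedOperator_apply`), and the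
rates follow from the sizes of D and 𝒦D, as operators and on one fixed eigenfunction φ₀ of 𝒦.

Abstract part (`exists_eigen_perturbation_bounds`, with T = 𝒦, T' = T − D). Riesz projections depend
Lipschitz-continuously on the operator, so for small D the projection E' of T' has rank one, with
eigenvalue λ'. For a unit vector φ in its range write φ = e + f with e = Eφ, and y = Dφ = (T − λ')φ.
Then Ey = (λ − λ')e and (T − λ')f = (I − E)y, so the reduced resolvent bounds f by y and ‖f‖ is of
the order δ of Dφ₀. Applying T once more gives ETy = λ(λ − λ')e and (T − λ')Tf = (I − E)Ty. Hence
the errors of the eigenvalue and of the iterated vector are governed by Ty, whose order η is that of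
TDφ₀ and of ‖TD‖δ.

Concrete part (`exists_norm_sub_modifiedOperator_le`,
`exists_norm_eigenfunction_sub_projection_le`). The Pₙ are uniformly bounded on L^∞, so projection
errors are comparable with the best cellwise polynomial approximation. Bootstrapping λφ₀ = 𝒦φ₀ makes
φ₀ smooth, whence (I − Pₙ)φ₀ = O(h^(2r+1)). On each cell 𝒦(I − Pₙ)x oscillates by O(h²) times ‖(I −
Pₙ)x‖, so the outer I − Pₙ gains h² and Dφ₀ = O(h^(2r+3)). Since PₙD = 0, 𝒦D = 𝒦(I − Pₙ)D.
Orthogonality to affine approximants of κ(s,·) off the diagonal gains a further h² if r ≥ 1; for r =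
0 only constants are available and the gain is h. The cell containing s, where κ(s,·) is merely
Lipschitz, has length h and does no harm. -/

lemma mem_resolventSet_iff_isUnit_sub_smul {A : Type*} [Ring A] [Algebra ℂ A] (T : A) (z : ℂ) :
    z ∈ resolventSet ℂ T ↔ IsUnit (T - z • (1 : A)) := by
  rw [spectrum.mem_resolventSet_iff, Algebra.algebraMap_eq_smul_one, IsUnit.sub_iff]

section Riesz

open Metric

variable {A : Type*} [NormedRing A] [NormedAlgebra ℂ A]

/-- The resolvent `(T - z)⁻¹`. -/
def res (T : A) (z : ℂ) : A := Ring.inverse (T - z • (1 : A))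

/-- The Riesz projection `-(2πi)⁻¹ ∮ (T - z)⁻¹ dz`. -/
def rieszProj (T : A) (c : ℂ) (ρ : ℝ) : A :=
  -((2 * Real.pi * Complex.I : ℂ)⁻¹ • ∮ z in C(c, ρ), res T z)

/-- The Cauchy transform `(2πi)⁻¹ ∮ (z - w)⁻¹ (T - z)⁻¹ dz` of the resolvent. -/
def cauchyRes (T : A) (c : ℂ) (ρ : ℝ) (w : ℂ) : A :=
  (2 * Real.pi * Complex.I : ℂ)⁻¹ • ∮ z in C(c, ρ), (z - w)⁻¹ • res T z

lemma sub_smul_mul_res {T : A} {z : ℂ} (hz : z ∈ resolventSet ℂ T) :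
    (T - z • (1 : A)) * res T z = 1 :=
  Ring.mul_inverse_cancel _ ((mem_resolventSet_iff_isUnit_sub_smul T z).1 hz)

lemma res_mul_sub_smul {T : A} {z : ℂ} (hz : z ∈ resolventSet ℂ T) :
    res T z * (T - z • (1 : A)) = 1 :=
  Ring.inverse_mul_cancel _ ((mem_resolventSet_iff_isUnit_sub_smul T z).1 hz)

lemma commute_res (T : A) (z : ℂ) : Commute T (res T z) := by
  by_cases hz : z ∈ resolventSet ℂ T
  · have h : Commute (T - z • (1 : A)) (res T z) := by
      rw [Commute, SemiconjBy, sub_smul_mul_res hz, res_mul_sub_smul hz]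
    have h1 : Commute (z • (1 : A)) (res T z) := (Commute.one_left _).smul_left z
    simpa using h.add_left h1
  · rw [mem_resolventSet_iff_isUnit_sub_smul] at hz
    rw [res, Ring.inverse_non_unit _ hz]
    exact Commute.zero_right _

variable [CompleteSpace A]

lemma differentiableAt_res {T : A} {z : ℂ} (hz : z ∈ resolventSet ℂ T) :
    DifferentiableAt ℂ (res T) z := by
  have h := differentiableAt_inverse (𝕜 := ℂ) ((mem_resolventSet_iff_isUnit_sub_smul T z).1 hz)
  exact DifferentiableAt.comp (f := fun z : ℂ => T - z • (1 : A)) z h (by fun_prop)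

lemma continuousOn_res {T : A} {s : Set ℂ} (hs : s ⊆ resolventSet ℂ T) :
    ContinuousOn (res T) s :=
  fun _ hz => (differentiableAt_res (hs hz)).continuousAt.continuousWithinAt

lemma clm_circleIntegral {F G : Type*} [NormedAddCommGroup F] [NormedSpace ℂ F] [CompleteSpace F]
    [NormedAddCommGroup G] [NormedSpace ℂ G] [CompleteSpace G] (L : F →L[ℂ] G) {f : ℂ → F} {c : ℂ}
    {ρ : ℝ} (hf : CircleIntegrable f c ρ) :
    ∮ z in C(c, ρ), L (f z) = L (∮ z in C(c, ρ), f z) := by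
  unfold circleIntegral
  rw [← L.intervalIntegral_comp_comm hf.out]
  simp

lemma circleIntegrable_res {T : A} {c : ℂ} {ρ : ℝ} (hρ : 0 < ρ)
    (hs : sphere c ρ ⊆ resolventSet ℂ T) : CircleIntegrable (res T) c ρ :=
  (continuousOn_res hs).circleIntegrable hρ.le

lemma sub_ne_zero_of_sphere_of_ball {c w z : ℂ} {ρ : ℝ} (hw : w ∈ ball c ρ)
    (hz : z ∈ sphere c ρ) : z - w ≠ 0 := by
  rw [sub_ne_zero]
  rintro rfl
  rw [mem_ball] at hw
  rw [mem_sphere] at hz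
  linarith

lemma circleIntegrable_cauchyRes {T : A} {c w : ℂ} {ρ : ℝ} (hρ : 0 < ρ)
    (hs : sphere c ρ ⊆ resolventSet ℂ T) (hw : w ∈ ball c ρ) :
    CircleIntegrable (fun z => (z - w)⁻¹ • res T z) c ρ := by
  refine ContinuousOn.circleIntegrable hρ.le (ContinuousOn.smul ?_ (continuousOn_res hs))
  exact ContinuousOn.inv₀ (by fun_prop) fun z hz => sub_ne_zero_of_sphere_of_ball hw hz

lemma commute_rieszProj {T : A} {c : ℂ} {ρ : ℝ} (hρ : 0 < ρ)
    (hs : sphere c ρ ⊆ resolventSet ℂ T) : Commute T (rieszProj T c ρ) := by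
  have hi := circleIntegrable_res hρ hs
  have h1 := clm_circleIntegral (ContinuousLinearMap.mul ℂ A T) hi
  have h2 := clm_circleIntegral ((ContinuousLinearMap.mul ℂ A).flip T) hi
  simp only [ContinuousLinearMap.mul_apply', ContinuousLinearMap.flip_apply] at h1 h2
  refine Commute.neg_right (Commute.smul_right ?_ _)
  rw [Commute, SemiconjBy, ← h1, ← h2]
  exact circleIntegral.integral_congr hρ.le fun z _ => commute_res T z

lemma commute_cauchyRes {T : A} {c w : ℂ} {ρ : ℝ} (hρ : 0 < ρ)
    (hs : sphere c ρ ⊆ resolventSet ℂ T) (hw : w ∈ ball c ρ) :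
    Commute T (cauchyRes T c ρ w) := by
  have hi := circleIntegrable_cauchyRes hρ hs hw
  have h1 := clm_circleIntegral (ContinuousLinearMap.mul ℂ A T) hi
  have h2 := clm_circleIntegral ((ContinuousLinearMap.mul ℂ A).flip T) hi
  simp only [ContinuousLinearMap.mul_apply', ContinuousLinearMap.flip_apply] at h1 h2
  refine Commute.smul_right ?_ _
  rw [Commute, SemiconjBy, ← h1, ← h2]
  exact circleIntegral.integral_congr hρ.le fun z _ => ((commute_res T z).smul_right _)

/-- Under the integral T − w = (T − z) + (z − w), which leaves ∮ (z − w)⁻¹ dz = 2πi and the integral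
of the resolvent. At w = λ the Cauchy transform thus serves as the reduced resolvent. -/
lemma sub_smul_mul_cauchyRes {T : A} {c w : ℂ} {ρ : ℝ} (hρ : 0 < ρ)
    (hs : sphere c ρ ⊆ resolventSet ℂ T) (hw : w ∈ ball c ρ) :
    (T - w • (1 : A)) * cauchyRes T c ρ w = 1 - rieszProj T c ρ := by
  have hi := circleIntegrable_cauchyRes hρ hs hw
  have h1 := clm_circleIntegral (ContinuousLinearMap.mul ℂ A (T - w • (1 : A))) hi
  simp only [ContinuousLinearMap.mul_apply'] at h1
  have hinv : CircleIntegrable (fun z => (z - w)⁻¹ • (1 : A)) c ρ := by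
    refine ContinuousOn.circleIntegrable hρ.le (ContinuousOn.smul ?_ (by fun_prop))
    exact ContinuousOn.inv₀ (by fun_prop) fun z hz => sub_ne_zero_of_sphere_of_ball hw hz
  have h2 : ∮ z in C(c, ρ), (T - w • (1 : A)) * ((z - w)⁻¹ • res T z)
      = (∮ z in C(c, ρ), (z - w)⁻¹ • (1 : A)) + ∮ z in C(c, ρ), res T z := by
    rw [← circleIntegral.integral_add hinv (circleIntegrable_res hρ hs)]
    refine circleIntegral.integral_congr hρ.le fun z hz => ?_
    have h3 : T - w • (1 : A) = (T - z • (1 : A)) + (z - w) • (1 : A) := by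
      rw [sub_smul]; abel
    rw [h3, add_mul, mul_smul_comm, sub_smul_mul_res (hs hz), smul_mul_assoc, one_mul, smul_smul,
      mul_inv_cancel₀ (sub_ne_zero_of_sphere_of_ball hw hz), one_smul]
  have hpi : (2 * Real.pi * Complex.I : ℂ) ≠ 0 := by simp [Real.pi_ne_zero]
  rw [cauchyRes, mul_smul_comm, ← h1, h2, circleIntegral.integral_smul_const,
    circleIntegral.integral_sub_inv_of_mem_ball hw, smul_add, smul_smul, inv_mul_cancel₀ hpi,
    one_smul, rieszProj, sub_neg_eq_add]

/-- In the proof of idempotence this replaces the double contour integral and the first resolvent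
identity. -/
lemma rieszProj_mul_res {T : A} {c w : ℂ} {ρ : ℝ} (hρ : 0 < ρ)
    (hs : sphere c ρ ⊆ resolventSet ℂ T) (hw : w ∈ ball c ρ) (hw' : w ∈ resolventSet ℂ T) :
    rieszProj T c ρ * res T w = res T w - cauchyRes T c ρ w := by
  have h := (commute_cauchyRes hρ hs hw).sub_left
    ((Commute.one_left (cauchyRes T c ρ w)).smul_left w)
  have h1 := sub_smul_mul_cauchyRes hρ hs hw
  rw [h.eq] at h1
  have h2 : rieszProj T c ρ = 1 - cauchyRes T c ρ w * (T - w • (1 : A)) := by rw [h1]; abel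
  rw [h2, sub_mul, mul_assoc, sub_smul_mul_res hw', one_mul, mul_one]

lemma differentiableOn_cauchyRes {T : A} {c : ℂ} {ρ : ℝ} (hρ : 0 < ρ)
    (hs : sphere c ρ ⊆ resolventSet ℂ T) : DifferentiableOn ℂ (cauchyRes T c ρ) (ball c ρ) := by
  lift ρ to NNReal using hρ.le
  have h := hasFPowerSeriesOn_cauchy_integral (circleIntegrable_res hρ hs) (by exact_mod_cast hρ)
  have := h.differentiableOn
  rwa [Metric.eball_coe] at this

/-- The part of the spectrum in the closed disc is compact and misses the circle, so its largest
distance from the centre is less than ρ. The inner circle leaves room for Cauchy transforms over the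
outer one to be holomorphic on the closed inner disc. -/
lemma exists_smaller_radius {T : A} {c : ℂ} {ρ : ℝ} (hρ : 0 < ρ)
    (hs : sphere c ρ ⊆ resolventSet ℂ T) :
    ∃ ρ', 0 < ρ' ∧ ρ' < ρ ∧ closedBall c ρ \ ball c ρ' ⊆ resolventSet ℂ T := by
  have hK : IsCompact (closedBall c ρ ∩ spectrum ℂ T) :=
    (isCompact_closedBall c ρ).inter_right (spectrum.isClosed T)
  have hsub : ∀ z ∈ closedBall c ρ ∩ spectrum ℂ T, dist z c < ρ := by
    rintro z ⟨hz, hz'⟩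
    refine lt_of_le_of_ne hz fun h => ?_
    exact hz' (hs h)
  have key : ∃ m < ρ, ∀ z ∈ closedBall c ρ ∩ spectrum ℂ T, dist z c ≤ m := by
    rcases (closedBall c ρ ∩ spectrum ℂ T).eq_empty_or_nonempty with h | h
    · exact ⟨0, hρ, by simp [h]⟩
    · obtain ⟨z₀, hz₀, hmax⟩ := hK.exists_isMaxOn h
        (f := fun z => dist z c) (by fun_prop)
      exact ⟨dist z₀ c, hsub z₀ hz₀, fun z hz => hmax hz⟩
  obtain ⟨m, hm, hm'⟩ := key
  refine ⟨(max m 0 + ρ) / 2, by positivity, ?_, ?_⟩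
  · have := max_lt hm hρ
    linarith
  · rintro z ⟨hz, hz'⟩
    by_contra hcon
    have h1 := hm' z ⟨hz, hcon⟩
    rw [mem_ball, not_lt] at hz'
    have := max_lt hm hρ
    have := le_max_left m 0
    linarith

/-- A Riesz projection is idempotent. -/
lemma rieszProj_mul_self {T : A} {c : ℂ} {ρ : ℝ} (hρ : 0 < ρ)
    (hs : sphere c ρ ⊆ resolventSet ℂ T) :
    rieszProj T c ρ * rieszProj T c ρ = rieszProj T c ρ := by
  obtain ⟨ρ', h0, hlt, hann⟩ := exists_smaller_radius hρ hs
  have hs' : sphere c ρ' ⊆ resolventSet ℂ T := fun z hz =>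
    hann ⟨sphere_subset_closedBall.trans (closedBall_subset_closedBall hlt.le) hz, by
      rw [mem_sphere] at hz; simp [hz]⟩
  have hint : ∮ z in C(c, ρ), res T z = ∮ z in C(c, ρ'), res T z := by
    refine Complex.circleIntegral_eq_of_differentiable_on_annulus_off_countable h0 hlt.le
      (s := ∅) countable_empty (continuousOn_res hann) ?_
    rintro z ⟨⟨hz, hz'⟩, _⟩
    exact differentiableAt_res (hann ⟨ball_subset_closedBall hz,
      fun h => hz' (ball_subset_closedBall h)⟩)
  have hE : rieszProj T c ρ = rieszProj T c ρ' := by rw [rieszProj, rieszProj, hint]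
  have hi := circleIntegrable_res h0 hs'
  have h1 := clm_circleIntegral (ContinuousLinearMap.mul ℂ A (rieszProj T c ρ)) hi
  simp only [ContinuousLinearMap.mul_apply'] at h1
  have hd := differentiableOn_cauchyRes hρ hs
  have hcb : closedBall c ρ' ⊆ ball c ρ := closedBall_subset_ball hlt
  have hcont : ContinuousOn (cauchyRes T c ρ) (closedBall c ρ') := hd.continuousOn.mono hcb
  -- Cauchy's theorem for the outer transform on the inner disc: integrating `rieszProj_mul_res`
  -- over the inner circle then leaves only the resolvent term, which is E * E = E.
  have hzero : ∮ w in C(c, ρ'), cauchyRes T c ρ w = 0 := by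
    refine Complex.circleIntegral_eq_zero_of_differentiable_on_off_countable h0.le
      (s := ∅) countable_empty hcont ?_
    rintro z ⟨hz, _⟩
    exact (hd z (hcb (ball_subset_closedBall hz))).differentiableAt
      (isOpen_ball.mem_nhds (hcb (ball_subset_closedBall hz)))
  have h2 : ∮ w in C(c, ρ'), rieszProj T c ρ * res T w = ∮ w in C(c, ρ'), res T w := by
    rw [← sub_zero (∮ w in C(c, ρ'), res T w), ← hzero, ← circleIntegral.integral_sub hi
      ((hcont.mono sphere_subset_closedBall).circleIntegrable h0.le)]
    exact circleIntegral.integral_congr h0.le fun w hw =>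
      rieszProj_mul_res hρ hs (hcb (sphere_subset_closedBall hw)) (hs' hw)
  conv_lhs => rw [hE]
  conv_lhs => enter [1]; rw [← hE]
  conv_lhs => enter [2]; rw [rieszProj]
  rw [mul_neg, mul_smul_comm, ← h1, h2, hE, rieszProj]

lemma exists_bound_res {T : A} {c : ℂ} {ρ : ℝ} (hs : sphere c ρ ⊆ resolventSet ℂ T) :
    ∃ M, 0 < M ∧ ∀ z ∈ sphere c ρ, ‖res T z‖ ≤ M := by
  obtain ⟨M, hM⟩ := (isCompact_sphere c ρ).exists_bound_of_continuousOn (continuousOn_res hs)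
  exact ⟨max M 1, by positivity, fun z hz => (hM z hz).trans (le_max_left _ _)⟩

/-- Stability of the resolvent set and Lipschitz dependence of the Riesz projection. -/
lemma exists_rieszProj_perturbation {T : A} {c : ℂ} {ρ : ℝ} (hρ : 0 < ρ)
    (hs : sphere c ρ ⊆ resolventSet ℂ T) :
    ∃ ε C : ℝ, 0 < ε ∧ 0 ≤ C ∧ ∀ T' : A, ‖T' - T‖ ≤ ε → sphere c ρ ⊆ resolventSet ℂ T' ∧
      ‖rieszProj T' c ρ - rieszProj T c ρ‖ ≤ C * ‖T' - T‖ := by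
  obtain ⟨M, hM0, hM⟩ := exists_bound_res hs
  -- The choice ε = 1/(2M) makes ‖res T z * (T' - T)‖ at most 1/2. The Neumann series then inverts
  -- T' - z, and absorbing half of ‖res T' z‖ bounds it by 2M. The factor ρ is the length of the
  -- circle divided by 2π.
  refine ⟨(2 * M)⁻¹, ρ * (2 * M * M), by positivity, by positivity, fun T' hT' => ?_⟩
  have hsmall : ∀ z ∈ sphere c ρ, ‖res T z * (T' - T)‖ ≤ 1 / 2 := fun z hz =>
    calc ‖res T z * (T' - T)‖ ≤ ‖res T z‖ * ‖T' - T‖ := norm_mul_le _ _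
      _ ≤ M * (2 * M)⁻¹ := by gcongr; exact hM z hz
      _ = 1 / 2 := by field_simp
  have hs' : sphere c ρ ⊆ resolventSet ℂ T' := fun z hz => by
    rw [mem_resolventSet_iff_isUnit_sub_smul]
    have hfac : T' - z • (1 : A) = (T - z • (1 : A)) * (1 - (-(res T z * (T' - T)))) := by
      rw [sub_neg_eq_add, mul_add, ← mul_assoc, sub_smul_mul_res (hs hz), mul_one, one_mul]
      abel
    rw [hfac]
    refine ((mem_resolventSet_iff_isUnit_sub_smul T z).1 (hs hz)).mul
      (isUnit_one_sub_of_norm_lt_one ?_)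
    rw [norm_neg]
    linarith [hsmall z hz]
  have hdiff : ∀ z ∈ sphere c ρ, res T' z - res T z = -(res T z * (T' - T) * res T' z) :=
    fun z hz => by
    have h1 : res T z * ((T' - z • (1 : A)) - (T - z • (1 : A))) * res T' z
        = res T z - res T' z := by
      rw [mul_sub, sub_mul, mul_assoc, sub_smul_mul_res (hs' hz), res_mul_sub_smul (hs hz),
        mul_one, one_mul]
    rw [sub_sub_sub_cancel_right] at h1
    rw [h1]; abel
  have hM' : ∀ z ∈ sphere c ρ, ‖res T' z‖ ≤ 2 * M := fun z hz => by
    have h1 : ‖res T' z‖ ≤ ‖res T z‖ + ‖res T z * (T' - T) * res T' z‖ := by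
      rw [show res T' z = res T z - res T z * (T' - T) * res T' z by
        rw [sub_eq_add_neg, ← hdiff z hz]; abel]
      refine (norm_sub_le _ _).trans (le_of_eq ?_)
      congr 2
      rw [show res T z - res T z * (T' - T) * res T' z = res T' z by
        rw [sub_eq_add_neg, ← hdiff z hz]; abel]
    have h2 : ‖res T z * (T' - T) * res T' z‖ ≤ 1 / 2 * ‖res T' z‖ :=
      (norm_mul_le _ _).trans (by gcongr; exact hsmall z hz)
    linarith [hM z hz]
  refine ⟨hs', ?_⟩
  have h1 : rieszProj T' c ρ - rieszProj T c ρ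
      = -((2 * Real.pi * Complex.I : ℂ)⁻¹ • ∮ z in C(c, ρ), (res T' z - res T z)) := by
    rw [circleIntegral.integral_sub (circleIntegrable_res hρ hs') (circleIntegrable_res hρ hs),
      rieszProj, rieszProj, smul_sub]
    abel
  rw [h1, norm_neg]
  have h2 := circleIntegral.norm_two_pi_i_inv_smul_integral_le_of_norm_le_const (c := c) hρ.le
    (f := fun z => res T' z - res T z) (C := 2 * M * M * ‖T' - T‖) (fun z hz => by
      rw [hdiff z hz, norm_neg]
      calc _ ≤ ‖res T z‖ * ‖T' - T‖ * ‖res T' z‖ := norm_mul₃_le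
        _ ≤ M * ‖T' - T‖ * (2 * M) := by
            gcongr
            · exact hM z hz
            · exact hM' z hz
        _ = _ := by ring)
  exact h2.trans (le_of_eq (by ring))

end Riesz

/-! ### Riesz projections applied to eigenvectors -/

section RieszOperator

open Metric

variable {X : Type*} [NormedAddCommGroup X] [NormedSpace ℂ X]

lemma res_apply_eigenvector {T : X →L[ℂ] X} {μ z : ℂ} {x : X} (hx : T x = μ • x)
    (hz : z ∈ resolventSet ℂ T) (hne : z - μ ≠ 0) : res T z x = -((z - μ)⁻¹ • x) := by
  have h1 : (T - z • (1 : X →L[ℂ] X)) x = -((z - μ) • x) := by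
    simp [hx, sub_smul]
  have h2 : res T z ((T - z • (1 : X →L[ℂ] X)) x) = x :=
    congrArg (fun L : X →L[ℂ] X => L x) (res_mul_sub_smul hz)
  rw [h1, map_neg, map_smul] at h2
  rw [← smul_neg, eq_inv_smul_iff₀ hne, ← neg_eq_iff_eq_neg]
  exact h2

variable [CompleteSpace X]

lemma rieszProj_apply {T : X →L[ℂ] X} {c : ℂ} {ρ : ℝ} (hρ : 0 < ρ)
    (hs : sphere c ρ ⊆ resolventSet ℂ T) (x : X) :
    rieszProj T c ρ x = -((2 * Real.pi * Complex.I : ℂ)⁻¹ • ∮ z in C(c, ρ), res T z x) := by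
  have h := clm_circleIntegral (ContinuousLinearMap.apply ℂ X x) (circleIntegrable_res hρ hs)
  simp only [ContinuousLinearMap.apply_apply] at h
  rw [h, rieszProj]
  simp

lemma rieszProj_eigenvector_of_mem_ball {T : X →L[ℂ] X} {c μ : ℂ} {ρ : ℝ} (hρ : 0 < ρ)
    (hs : sphere c ρ ⊆ resolventSet ℂ T) (hμ : μ ∈ ball c ρ) {x : X} (hx : T x = μ • x) :
    rieszProj T c ρ x = x := by
  have hpi : (2 * Real.pi * Complex.I : ℂ) ≠ 0 := by simp [Real.pi_ne_zero]
  rw [rieszProj_apply hρ hs, circleIntegral.integral_congr hρ.le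
    (g := fun z => (z - μ)⁻¹ • (-x)) fun z hz => by
      simp only [smul_neg]
      exact res_apply_eigenvector hx (hs hz) (sub_ne_zero_of_sphere_of_ball hμ hz)]
  rw [circleIntegral.integral_smul_const, circleIntegral.integral_sub_inv_of_mem_ball hμ, smul_smul,
    inv_mul_cancel₀ hpi, one_smul, neg_neg]

lemma rieszProj_eigenvector_of_notMem_closedBall {T : X →L[ℂ] X} {c μ : ℂ} {ρ : ℝ} (hρ : 0 < ρ)
    (hs : sphere c ρ ⊆ resolventSet ℂ T) (hμ : μ ∉ closedBall c ρ) {x : X} (hx : T x = μ • x) :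
    rieszProj T c ρ x = 0 := by
  have hne : ∀ z ∈ closedBall c ρ, z - μ ≠ 0 := fun z hz h => by
    rw [sub_eq_zero] at h
    exact hμ (h ▸ hz)
  rw [rieszProj_apply hρ hs, circleIntegral.integral_congr hρ.le
    (g := fun z => (z - μ)⁻¹ • (-x)) fun z hz => by
      simp only [smul_neg]
      exact res_apply_eigenvector hx (hs hz) (hne z (sphere_subset_closedBall hz))]
  rw [circleIntegral.integral_smul_const,
    Complex.circleIntegral_eq_zero_of_differentiable_on_off_countable hρ.le (s := ∅)
      countable_empty]
  · simp
  · exact ContinuousOn.inv₀ (by fun_prop) hne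
  · rintro z ⟨hz, _⟩
    exact DifferentiableAt.inv (by fun_prop) (hne z (ball_subset_closedBall hz))

end RieszOperator

/-! ### Perturbation of a simple isolated eigenvalue -/

section Perturbation

open Metric

variable {X : Type*} [NormedAddCommGroup X] [NormedSpace ℂ X]

/-- A bounded projection close to a rank-one projection has rank one. -/
lemma finrank_range_eq_one_of_close {E E' : X →L[ℂ] X} {φ₀ : X} (h0 : φ₀ ≠ 0) (hφ₀ : E φ₀ = φ₀)
    (hE : ∀ x, ∃ a : ℂ, E x = a • φ₀) (hE' : ∀ x, E' (E' x) = E' x) (hclose : ‖E' - E‖ < 1) :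
    Module.finrank ℂ (LinearMap.range (E' : X →ₗ[ℂ] X)) = 1 := by
  have hlt : ∀ y : X, y ≠ 0 → ‖E' y - E y‖ < ‖y‖ := fun y hy =>
    calc ‖E' y - E y‖ ≤ ‖E' - E‖ * ‖y‖ := (E' - E).le_opNorm y
      _ < 1 * ‖y‖ := by gcongr
      _ = ‖y‖ := one_mul _
  -- E is injective on the range of E', because a nonzero fixed vector of E' killed by E would be
  -- moved by E' - E by its full norm. As E has rank one, so has E'.
  have hinj : ∀ y, E' y = y → E y = 0 → y = 0 := fun y h1 h2 => by
    by_contra hy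
    have := hlt y hy
    rw [h1, h2, sub_zero] at this
    exact lt_irrefl _ this
  have h1 : E' φ₀ ≠ 0 := fun h => by
    have := hlt φ₀ h0
    rw [h, hφ₀, zero_sub, norm_neg] at this
    exact lt_irrefl _ this
  obtain ⟨b, hb⟩ := hE (E' φ₀)
  have hb0 : b ≠ 0 := fun h => h1 (hinj _ (hE' _) (by rw [hb, h, zero_smul]))
  refine (finrank_eq_one_iff_of_nonzero' (⟨E' φ₀, φ₀, rfl⟩ : LinearMap.range (E' : X →ₗ[ℂ] X))
    (by simpa [Subtype.ext_iff] using h1)).2 ?_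
  rintro ⟨_, x, rfl⟩
  obtain ⟨a, ha⟩ := hE (E' x)
  refine ⟨a / b, Subtype.ext ?_⟩
  have : E' x - (a / b) • E' φ₀ = 0 := by
    refine hinj _ (by simp [hE']) ?_
    rw [map_sub, map_smul, ha, hb, smul_smul, div_mul_cancel₀ _ hb0, sub_self]
  exact (sub_eq_zero.1 this).symm

/-- A-priori bound on the complement of an isolated eigenvalue through the reduced resolvent `S`. -/
lemma norm_le_of_reduced_resolvent {K E S : X →L[ℂ] X} {lam μ : ℂ}
    (hS : ∀ x, S (K x - lam • x) = x - E x) (hμ : ‖lam - μ‖ * ‖S‖ ≤ 1 / 2) {v y : X}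
    (hv : E v = 0) (h : K v - μ • v = y - E y) :
    ‖v‖ ≤ 2 * ‖S‖ * ‖(1 : X →L[ℂ] X) - E‖ * ‖y‖ := by
  -- Apply S to Kv − λv = (I − E)y − (λ − μ)v. As Ev = 0 the left side becomes v, and the last term
  -- is absorbed, whence the factor 2.
  have h1 : v = S (((1 : X →L[ℂ] X) - E) y) - (lam - μ) • S v := by
    have h2 := hS v
    rw [hv, sub_zero] at h2
    have h3 : K v - lam • v = ((1 : X →L[ℂ] X) - E) y - (lam - μ) • v := by
      rw [sub_smul, sub_apply, one_apply_eq_self, ← h]; abel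
    rw [h3, map_sub, map_smul] at h2
    exact h2.symm
  have h2 : ‖v‖ ≤ ‖S‖ * (‖(1 : X →L[ℂ] X) - E‖ * ‖y‖) + ‖lam - μ‖ * (‖S‖ * ‖v‖) :=
    calc ‖v‖ = ‖S (((1 : X →L[ℂ] X) - E) y) - (lam - μ) • S v‖ := by rw [← h1]
      _ ≤ ‖S (((1 : X →L[ℂ] X) - E) y)‖ + ‖(lam - μ) • S v‖ := norm_sub_le _ _
      _ ≤ _ := by
        rw [norm_smul]
        gcongr
        · exact S.le_opNorm_of_le (((1 : X →L[ℂ] X) - E).le_opNorm y)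
        · exact S.le_opNorm v
  have h3 : ‖lam - μ‖ * (‖S‖ * ‖v‖) ≤ 1 / 2 * ‖v‖ := by
    rw [← mul_assoc]; gcongr
  linarith

variable [CompleteSpace X]

/-- For w ≠ μ in the disc, T − w acts as the scalar μ − w on the range of E and is inverted by the
Cauchy transform up to E, so S + (μ − w)⁻¹E is a two-sided inverse. The point μ lies inside the
circle because otherwise the Riesz projection would annihilate φ. -/
lemma ball_inter_spectrum_of_rank_one {T : X →L[ℂ] X} {c μ : ℂ} {ρ : ℝ} (hρ : 0 < ρ)
    (hs : sphere c ρ ⊆ resolventSet ℂ T) {φ : X} (hφ : φ ≠ 0) (hTφ : T φ = μ • φ)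
    (hEφ : rieszProj T c ρ φ = φ) (hE : ∀ x, ∃ a : ℂ, rieszProj T c ρ x = a • φ) :
    ball c ρ ∩ spectrum ℂ T = {μ} := by
  have hspec : μ ∈ spectrum ℂ T := fun h => by
    have h1 := congrArg (fun L : X →L[ℂ] X => L φ) (res_mul_sub_smul h)
    have h2 : (T - μ • (1 : X →L[ℂ] X)) φ = 0 := by simp [hTφ]
    simp only [mul_apply_eq_comp, h2, map_zero, one_apply_eq_self] at h1
    exact hφ h1.symm
  have hball : μ ∈ ball c ρ := by
    by_contra hcon
    have hcl : μ ∉ closedBall c ρ := fun h => by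
      refine hspec (hs ?_)
      rw [mem_ball, not_lt] at hcon
      exact le_antisymm h hcon
    exact hφ (hEφ ▸ rieszProj_eigenvector_of_notMem_closedBall hρ hs hcl hTφ)
  ext w
  simp only [mem_inter_iff, mem_singleton_iff]
  refine ⟨fun ⟨hw, hw'⟩ => ?_, fun h => h ▸ ⟨hball, hspec⟩⟩
  by_contra hne
  refine hw' ((mem_resolventSet_iff_isUnit_sub_smul T w).2 ?_)
  have hne' : μ - w ≠ 0 := sub_ne_zero.2 (Ne.symm hne)
  set E := rieszProj T c ρ
  set S := cauchyRes T c ρ w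
  have h1 : (T - w • (1 : X →L[ℂ] X)) * E = (μ - w) • E := by
    ext x
    obtain ⟨a, ha⟩ := hE x
    simp only [mul_apply_eq_comp, sub_apply,
      smul_apply, one_apply_eq_self, ha, map_smul, hTφ]
    module
  have h2 : (T - w • (1 : X →L[ℂ] X)) * (S + (μ - w)⁻¹ • E) = 1 := by
    rw [mul_add, mul_smul_comm, h1, smul_smul, inv_mul_cancel₀ hne', one_smul,
      sub_smul_mul_cauchyRes hρ hs hw]
    abel
  have hc : Commute (T - w • (1 : X →L[ℂ] X)) (S + (μ - w)⁻¹ • E) :=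
    Commute.sub_left ((commute_cauchyRes hρ hs hw).add_right
      ((commute_rieszProj hρ hs).smul_right _)) ((Commute.one_left _).smul_left _)
  exact ⟨⟨_, _, h2, hc.eq ▸ h2⟩, rfl⟩

set_option maxHeartbeats 1000000 in
/-- Abstract superconvergence of eigenelements under the perturbation `T' = T - D`. -/
theorem exists_eigen_perturbation_bounds {T : X →L[ℂ] X} {lam : ℂ} (hlam : lam ≠ 0)
    {φ₀ : X} (h0 : φ₀ ≠ 0) (hφ₀ : T φ₀ = lam • φ₀) {ρ : ℝ} (hρ : 0 < ρ)
    (hiso : closedBall lam ρ ∩ spectrum ℂ T = {lam})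
    (hsimple : Module.finrank ℂ (LinearMap.range ((rieszProj T lam ρ : X →L[ℂ] X) : X →ₗ[ℂ] X)) = 1) :
    ∃ ε C : ℝ, 0 < ε ∧ 0 ≤ C ∧ ∀ T' : X →L[ℂ] X, ‖T - T'‖ ≤ ε → ∀ δ η : ℝ, 0 ≤ δ →
      ‖(T - T') φ₀‖ ≤ δ * ‖φ₀‖ → ‖T ((T - T') φ₀)‖ ≤ η * ‖φ₀‖ → ‖T ∘L (T - T')‖ * δ ≤ η →
      sphere lam ρ ⊆ resolventSet ℂ T' ∧
      Module.finrank ℂ (LinearMap.range ((rieszProj T' lam ρ : X →L[ℂ] X) : X →ₗ[ℂ] X)) = 1 ∧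
      ∃ lam' : ℂ, ball lam ρ ∩ spectrum ℂ T' = {lam'} ∧ lam' ≠ 0 ∧ ‖lam - lam'‖ ≤ C * η ∧
        ∀ φ ∈ LinearMap.range ((rieszProj T' lam ρ : X →L[ℂ] X) : X →ₗ[ℂ] X), ‖φ‖ = 1 →
          T' φ = lam' • φ ∧ ‖φ - rieszProj T lam ρ φ‖ ≤ C * δ ∧
          ‖lam'⁻¹ • T φ - rieszProj T lam ρ (lam'⁻¹ • T φ)‖ ≤ C * η := by
  have hs : sphere lam ρ ⊆ resolventSet ℂ T := fun z hz => by
    by_contra hcon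
    have : z ∈ ({lam} : Set ℂ) := hiso ▸ ⟨sphere_subset_closedBall hz, hcon⟩
    rw [mem_singleton_iff] at this
    subst this
    simp at hz
    exact hρ.ne hz
  have hlb : lam ∈ ball lam ρ := mem_ball_self hρ
  obtain ⟨ε₁, C₁, hε₁, hC₁, hpert⟩ := exists_rieszProj_perturbation hρ hs
  have hcomm := commute_rieszProj hρ hs
  have hidem := rieszProj_mul_self hρ hs
  have hSK := sub_smul_mul_cauchyRes hρ hs hlb
  rw [((commute_cauchyRes hρ hs hlb).sub_left ((Commute.one_left _).smul_left lam)).eq] at hSK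
  have hEφ₀ := rieszProj_eigenvector_of_mem_ball hρ hs hlb hφ₀
  set E := rieszProj T lam ρ
  set S := cauchyRes T lam ρ lam
  have hS : ∀ x, S (T x - lam • x) = x - E x := fun x => by
    simpa using congrArg (fun L : X →L[ℂ] X => L x) hSK
  have hTE : ∀ x, T (E x) = E (T x) := fun x => congrArg (fun L : X →L[ℂ] X => L x) hcomm.eq
  have hEE : ∀ x, E (E x) = E x := fun x => congrArg (fun L : X →L[ℂ] X => L x) hidem
  have hE1 : ∀ x, ∃ a : ℂ, E x = a • φ₀ := fun x => by
    obtain ⟨a, ha⟩ := (finrank_eq_one_iff_of_nonzero'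
      (⟨φ₀, φ₀, hEφ₀⟩ : LinearMap.range (E : X →ₗ[ℂ] X))
      (by simpa [Subtype.ext_iff] using h0)).1 hsimple ⟨E x, x, rfl⟩
    exact ⟨a, (congrArg Subtype.val ha).symm⟩
  have hTEl : ∀ x, T (E x) = lam • E x := fun x => by
    obtain ⟨a, ha⟩ := hE1 x
    rw [ha, map_smul, hφ₀, smul_comm]
  set a := ‖E‖
  set s := ‖S‖
  set b := ‖(1 : X →L[ℂ] X) - E‖
  have ha : 0 ≤ a := norm_nonneg _
  have hb : 0 ≤ b := norm_nonneg _
  have hs0 : 0 ≤ s := norm_nonneg _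
  have hl0 : 0 < ‖lam‖ := norm_pos_iff.2 hlam
  -- Q dominates every coefficient that has to be absorbed below, so the single threshold 1/(2Q) on
  -- ‖T - T'‖ brings all these products down to 1/2.
  set Q := C₁ + 4 * a / ‖lam‖ + 2 * a * s + 2 * s * b + 1
  have hQ1 : C₁ ≤ Q := by have : 0 ≤ 4 * a / ‖lam‖ + 2 * a * s + 2 * s * b + 1 := by positivity
                          linarith
  have hQ2 : 4 * a / ‖lam‖ ≤ Q := by have : 0 ≤ C₁ + 2 * a * s + 2 * s * b + 1 := by positivity
                                     linarith
  have hQ3 : 2 * a * s ≤ Q := by have : 0 ≤ C₁ + 4 * a / ‖lam‖ + 2 * s * b + 1 := by positivity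
                                 linarith
  have hQ4 : 2 * s * b ≤ Q := by have : 0 ≤ C₁ + 4 * a / ‖lam‖ + 2 * a * s + 1 := by positivity
                                 linarith
  have hQ0 : 0 < Q := by positivity
  -- The coefficient in ‖Ty‖ ≤ c₁η: a comes from the component e, and 4sba from f.
  set c₁ := a + 4 * s * b * a
  have hc₁ : 0 ≤ c₁ := by positivity
  refine ⟨min ε₁ (1 / (2 * Q)), 4 * s * b * a + 2 * a * c₁ / ‖lam‖ + 4 * s * b * c₁ / ‖lam‖,
    by positivity, by positivity, fun T' hT' δ η hδ hδφ hηφ hδη => ?_⟩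
  have hη : 0 ≤ η := (mul_nonneg (norm_nonneg _) hδ).trans hδη
  have hD1 : ‖T - T'‖ ≤ ε₁ := hT'.trans (min_le_left _ _)
  have hD2 : ∀ q, 0 ≤ q → q ≤ Q → q * ‖T - T'‖ ≤ 1 / 2 := fun q hq hqQ =>
    calc q * ‖T - T'‖ ≤ Q * (1 / (2 * Q)) := by gcongr; exact hT'.trans (min_le_right _ _)
      _ = 1 / 2 := by field_simp
  obtain ⟨hs', hEE'⟩ := hpert T' (by rwa [norm_sub_rev])
  rw [norm_sub_rev T' T] at hEE'
  have hclose := hEE'.trans (hD2 C₁ hC₁ hQ1)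
  have hidem' := rieszProj_mul_self hρ hs'
  have hcomm' := commute_rieszProj hρ hs'
  set E' := rieszProj T' lam ρ
  have hE'E' : ∀ x, E' (E' x) = E' x := fun x => congrArg (fun L : X →L[ℂ] X => L x) hidem'
  have hTE' : ∀ x, T' (E' x) = E' (T' x) := fun x =>
    congrArg (fun L : X →L[ℂ] X => L x) hcomm'.eq
  have hrank := finrank_range_eq_one_of_close h0 hEφ₀ hE1 hE'E' (by linarith)
  refine ⟨hs', hrank, ?_⟩
  obtain ⟨⟨φ', hφ'⟩, hne, hspan⟩ := finrank_eq_one_iff'.1 hrank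
  have hφ'0 : φ' ≠ 0 := fun h => hne (by simp [Subtype.ext_iff, h])
  have hE'φ' : E' φ' = φ' := by
    obtain ⟨x, rfl⟩ := hφ'
    exact hE'E' x
  have hspan' : ∀ x, ∃ a : ℂ, E' x = a • φ' := fun x => by
    obtain ⟨a, ha⟩ := hspan ⟨E' x, x, rfl⟩
    exact ⟨a, (congrArg Subtype.val ha).symm⟩
  obtain ⟨lam', hlam'⟩ := hspan' (T' φ')
  rw [← hTE', hE'φ'] at hlam'
  have heig : ∀ φ ∈ LinearMap.range (E' : X →ₗ[ℂ] X), T' φ = lam' • φ := by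
    rintro _ ⟨x, rfl⟩
    obtain ⟨a, ha⟩ := hspan' x
    rw [ContinuousLinearMap.coe_coe, ha, map_smul, hlam', smul_comm]
  have hE'φ : ∀ φ ∈ LinearMap.range (E' : X →ₗ[ℂ] X), E' φ = φ := by
    rintro _ ⟨x, rfl⟩
    exact hE'E' x
  -- The bounds δ and η are given on φ₀ only; since φ₀ spans the range of E, homogeneity extends
  -- them to that range.
  have hDE : ∀ x, ‖(T - T') (E x)‖ ≤ δ * ‖E x‖ := fun x => by
    obtain ⟨q, hq⟩ := hE1 x
    rw [hq, map_smul, norm_smul, norm_smul, mul_left_comm]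
    gcongr
  have hTDE : ∀ x, ‖T ((T - T') (E x))‖ ≤ η * ‖E x‖ := fun x => by
    obtain ⟨q, hq⟩ := hE1 x
    rw [hq, map_smul, map_smul, norm_smul, norm_smul, mul_left_comm]
    gcongr
  have key : ∀ φ ∈ LinearMap.range (E' : X →ₗ[ℂ] X), ‖φ‖ = 1 →
      2 * ‖lam - lam'‖ ≤ ‖lam‖ ∧ ‖lam - lam'‖ ≤ 2 * a * c₁ / ‖lam‖ * η ∧
      ‖φ - E φ‖ ≤ 4 * s * b * a * δ ∧ ‖T φ - E (T φ)‖ ≤ 2 * s * b * c₁ * η := by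
    intro φ hφ hφ1
    have hT'φ := heig φ hφ
    have hφE : E φ + (φ - E φ) = φ := by abel
    set e := E φ with he
    set f := φ - E φ with hf
    have hfe : ‖f‖ ≤ 1 / 2 := by
      have : f = (E' - E) φ := by
        rw [sub_apply, hE'φ φ hφ]
      rw [this]
      refine ((E' - E).le_opNorm φ).trans ?_
      rw [hφ1, mul_one]
      exact hclose
    -- A lower bound on e is what allows λ − λ' to be read off from multiples of e.
    have he1 : 1 / 2 ≤ ‖e‖ := by
      have := norm_add_le e f
      rw [hφE, hφ1] at this
      linarith
    have hea : ‖e‖ ≤ a := by simpa [hφ1] using E.le_opNorm φ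
    have hEf : E f = 0 := by rw [hf, map_sub, hEE, sub_self]
    set y := (T - T') φ with hy
    have hyT : y = T φ - lam' • φ := by rw [hy, sub_apply, hT'φ]
    have hEy : E y = (lam - lam') • e := by
      rw [hyT, map_sub, map_smul, ← hTE, hTEl, sub_smul]
    have hlamD : ‖lam - lam'‖ ≤ 2 * a * ‖T - T'‖ := by
      have h1 : ‖E y‖ ≤ a * ‖T - T'‖ := by
        refine E.le_opNorm_of_le ?_
        have h2 := (T - T').le_opNorm φ
        rwa [hφ1, mul_one] at h2
      rw [hEy, norm_smul] at h1
      nlinarith [norm_nonneg (lam - lam')]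
    have hlams : ‖lam - lam'‖ * s ≤ 1 / 2 := by
      refine le_trans ?_ (hD2 (2 * a * s) (by positivity) hQ3)
      calc _ ≤ 2 * a * ‖T - T'‖ * s := by gcongr
        _ = _ := by ring
    have hlamhalf : 2 * ‖lam - lam'‖ ≤ ‖lam‖ := by
      have h1 := hD2 (4 * a / ‖lam‖) (by positivity) hQ2
      rw [div_mul_eq_mul_div, div_le_iff₀ hl0] at h1
      linarith
    have hTf : T f - lam' • f = y - E y := by
      rw [hEy, hyT, hf, map_sub, hTEl]
      module
    have hf1 : ‖f‖ ≤ 2 * s * b * ‖y‖ := norm_le_of_reduced_resolvent hS hlams hEf hTf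
    have hyle : ‖y‖ ≤ δ * a + ‖T - T'‖ * ‖f‖ := by
      rw [hy, ← hφE, map_add]
      refine (norm_add_le _ _).trans (add_le_add ?_ ((T - T').le_opNorm f))
      exact (hDE φ).trans (by gcongr)
    -- The unknown f reappears in the bound of y through ‖T - T'‖‖f‖; its total coefficient is at
    -- most 1/2.
    have hfδ : ‖f‖ ≤ 4 * s * b * a * δ := by
      have h1 : ‖f‖ ≤ 2 * s * b * (δ * a + ‖T - T'‖ * ‖f‖) := hf1.trans (by gcongr)
      have h2 : 2 * s * b * ‖T - T'‖ * ‖f‖ ≤ 1 / 2 * ‖f‖ := by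
        gcongr; exact hD2 _ (by positivity) hQ4
      linarith
    -- The hypothesis ‖T(T − T')‖δ ≤ η enters here: f is only of order δ, yet T(T − T')f must be of
    -- order η.
    have hTy : ‖T y‖ ≤ c₁ * η := by
      rw [hy, ← hφE, map_add, map_add]
      have h2 : ‖T ((T - T') f)‖ ≤ 4 * s * b * a * η :=
        calc ‖T ((T - T') f)‖ ≤ ‖T ∘L (T - T')‖ * ‖f‖ := (T ∘L (T - T')).le_opNorm f
          _ ≤ ‖T ∘L (T - T')‖ * (4 * s * b * a * δ) := by gcongr
          _ = 4 * s * b * a * (‖T ∘L (T - T')‖ * δ) := by ring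
          _ ≤ 4 * s * b * a * η := by gcongr
      have h1 : ‖T ((T - T') e)‖ ≤ η * a := (hTDE φ).trans (by gcongr)
      calc _ ≤ ‖T ((T - T') e)‖ + ‖T ((T - T') f)‖ := norm_add_le _ _
        _ ≤ η * a + 4 * s * b * a * η := add_le_add h1 h2
        _ = c₁ * η := by ring
    refine ⟨hlamhalf, ?_, hfδ, ?_⟩
    -- Applying T before E replaces ‖y‖ by the smaller-order ‖Ty‖, at the price of dividing by λ.
    · have h1 : lam • (lam - lam') • e = E (T y) := by
        rw [← hTE, hEy, map_smul, hTEl, smul_comm]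
      have h2 : ‖lam‖ * (‖lam - lam'‖ * ‖e‖) ≤ a * (c₁ * η) := by
        rw [← norm_smul, ← norm_smul, h1]
        exact E.le_opNorm_of_le hTy
      have h3 : ‖lam‖ * (‖lam - lam'‖ * (1 / 2)) ≤ a * (c₁ * η) := le_trans (by gcongr) h2
      rw [div_mul_eq_mul_div, le_div_iff₀ hl0]
      linarith
    · have h1 : T φ - E (T φ) = T f := by rw [hf, map_sub, hTE]
      have h2 : T (T f) - lam' • T f = T y - E (T y) := by
        rw [← map_smul, ← map_sub, hTf, map_sub, hTE]
      rw [h1]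
      have h3 := norm_le_of_reduced_resolvent hS hlams (v := T f) (by rw [← hTE, hEf, map_zero]) h2
      refine h3.trans ?_
      calc 2 * s * b * ‖T y‖ ≤ 2 * s * b * (c₁ * η) := by gcongr
        _ = _ := by ring
  -- The bounds on `lam'` alone need some unit vector in the range; the normalised generator
  -- provides one.
  have hnormal := key ((‖φ'‖⁻¹ : ℂ) • φ') (Submodule.smul_mem _ _ hφ') (by
    rw [norm_smul, norm_inv, Complex.norm_real, norm_norm,
      inv_mul_cancel₀ (norm_ne_zero_iff.2 hφ'0)])
  have hlamhalf : ‖lam‖ / 2 ≤ ‖lam'‖ := by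
    have h1 : ‖lam‖ ≤ ‖lam - lam'‖ + ‖lam'‖ := by simpa using norm_add_le (lam - lam') lam'
    linarith [hnormal.1]
  have hlam'0 : 0 < ‖lam'‖ := lt_of_lt_of_le (by positivity) hlamhalf
  have hA : 0 ≤ 4 * s * b * a := by positivity
  have hB : 0 ≤ 2 * a * c₁ / ‖lam‖ := by positivity
  have hC : 0 ≤ 4 * s * b * c₁ / ‖lam‖ := by positivity
  refine ⟨lam', ball_inter_spectrum_of_rank_one hρ hs' hφ'0 hlam' hE'φ' hspan',
    norm_pos_iff.1 hlam'0, hnormal.2.1.trans (by gcongr; linarith), fun φ hφ hφ1 => ?_⟩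
  obtain ⟨-, -, k3, k4⟩ := key φ hφ hφ1
  refine ⟨heig φ hφ, k3.trans (by gcongr; linarith), ?_⟩
  rw [map_smul, ← smul_sub, norm_smul, norm_inv]
  calc ‖lam'‖⁻¹ * ‖T φ - E (T φ)‖ ≤ (‖lam‖ / 2)⁻¹ * (2 * s * b * c₁ * η) := by gcongr
    _ = 4 * s * b * c₁ / ‖lam‖ * η := by field_simp; ring
    _ ≤ _ := by gcongr; linarith

end Perturbation

/-! ### Inverse estimates for polynomials of bounded degree -/

open Polynomial in
/-- On polynomials of bounded degree the supremum over `[0,1]` is controlled by the `L²` norm. -/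
lemma exists_sup_sq_le_integral_unit (d : ℕ) : ∃ C : ℝ, 0 ≤ C ∧ ∀ p : ℂ[X], p.natDegree ≤ d →
    ∀ u ∈ Icc (0 : ℝ) 1, ‖p.eval (u : ℂ)‖ ^ 2 ≤ C * ∫ t in (0 : ℝ)..1, ‖p.eval (t : ℂ)‖ ^ 2 := by
  -- Polynomials are parametrised by coefficient vectors. The squared L² norm is continuous and
  -- positive on the compact unit sphere of coefficients, and its minimum there controls all vectors
  -- by homogeneity.
  let f : (Fin (d + 1) → ℂ) → ℝ → ℂ := fun c t => ∑ k, c k * (t : ℂ) ^ (k : ℕ)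
  have hf : Continuous (Function.uncurry f) := by
    refine continuous_finsetSum _ fun k _ => ?_
    exact ((continuous_apply k).comp continuous_fst).mul
      ((Complex.continuous_ofReal.comp continuous_snd).pow _)
  let N : (Fin (d + 1) → ℂ) → ℝ := fun c => ∫ t in (0 : ℝ)..1, ‖f c t‖ ^ 2
  have hN : Continuous N :=
    intervalIntegral.continuous_parametric_intervalIntegral_of_continuous'
      (f := fun c t => ‖f c t‖ ^ 2) (hf.norm.fun_pow 2) 0 1
  have hfc : ∀ c, Continuous (f c) := fun c => hf.comp (by fun_prop : Continuous fun t => (c, t))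
  have hpos : ∀ c ∈ Metric.sphere (0 : Fin (d + 1) → ℂ) 1, 0 < N c := by
    intro c hc
    have hc0 : c ≠ 0 := by rintro rfl; simp at hc
    let p : ℂ[X] := ∑ k : Fin (d + 1), Polynomial.monomial k (c k)
    have hp : p ≠ 0 := fun h => hc0 <| by
      ext j
      have h1 := congrArg (fun q => Polynomial.coeff q j) h
      simp only [p, Polynomial.finsetSum_coeff, Polynomial.coeff_monomial,
        Polynomial.coeff_zero] at h1
      simpa [Fin.val_inj] using h1
    have hpe : ∀ t : ℝ, p.eval (t : ℂ) = f c t := fun t => by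
      simp [p, f, Polynomial.eval_finsetSum]
    refine intervalIntegral.integral_pos one_pos ((hfc c).norm.pow 2).continuousOn
      (fun _ _ => by positivity) ?_
    by_contra hcon
    push Not at hcon
    have hroot : ((fun t : ℝ => (t : ℂ)) '' Icc (0 : ℝ) 1) ⊆ {z | p.IsRoot z} := by
      rintro _ ⟨t, ht, rfl⟩
      have h1 : ‖f c t‖ ^ 2 = 0 := le_antisymm (hcon t ht) (by positivity)
      simp only [mem_ofPred_eq, Polynomial.IsRoot.def, hpe]
      simpa using h1
    exact ((Icc_infinite one_pos).image Complex.ofReal_injective.injOn)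
      ((Polynomial.finite_setOfPred_isRoot hp).subset hroot)
  obtain ⟨c₀, hc₀, hmin⟩ := (isCompact_sphere (0 : Fin (d + 1) → ℂ) 1).exists_isMinOn
    (NormedSpace.sphere_nonempty.2 zero_le_one) hN.continuousOn
  have hm := hpos c₀ hc₀
  have hscale : ∀ c : Fin (d + 1) → ℂ, ‖c‖ ^ 2 * N c₀ ≤ N c := by
    intro c
    by_cases hc : c = 0
    · simp only [hc, norm_zero, ne_eq, OfNat.ofNat_ne_zero, not_false_eq_true, zero_pow, zero_mul]
      exact intervalIntegral.integral_nonneg zero_le_one fun _ _ => by positivity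
    · have hn : ‖c‖ ≠ 0 := norm_ne_zero_iff.2 hc
      have h1 : N c₀ ≤ N (((‖c‖⁻¹ : ℝ) : ℂ) • c) := by
        refine hmin ?_
        rw [mem_sphere_zero_iff_norm, norm_smul, Complex.norm_real, norm_inv, norm_norm,
          inv_mul_cancel₀ hn]
      have h2 : N (((‖c‖⁻¹ : ℝ) : ℂ) • c) = (‖c‖⁻¹) ^ 2 * N c := by
        simp only [N]
        rw [← intervalIntegral.integral_const_mul]
        congr 1
        ext t
        have : f (((‖c‖⁻¹ : ℝ) : ℂ) • c) t = ((‖c‖⁻¹ : ℝ) : ℂ) * f c t := by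
          simp only [f, Pi.smul_apply, smul_eq_mul, Finset.mul_sum, mul_assoc]
        rw [this, norm_mul, mul_pow, Complex.norm_real, norm_inv, norm_norm]
      rw [h2] at h1
      calc ‖c‖ ^ 2 * N c₀ ≤ ‖c‖ ^ 2 * ((‖c‖⁻¹) ^ 2 * N c) := by gcongr
        _ = N c := by field_simp
  -- Each of the d + 1 monomial terms is at most ‖c‖ on [0,1], and `N c₀` is the minimum over the
  -- sphere.
  refine ⟨((d + 1 : ℕ) : ℝ) ^ 2 / N c₀, by positivity, fun p hp u hu => ?_⟩
  let c : Fin (d + 1) → ℂ := fun k => p.coeff k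
  have hpe : ∀ t : ℝ, p.eval (t : ℂ) = f c t := fun t => by
    rw [Polynomial.eval_eq_sum_range' (Nat.lt_succ_of_le hp)]
    simp only [f, c]
    rw [Fin.sum_univ_eq_sum_range fun k => p.coeff k * (t : ℂ) ^ k]
  simp only [hpe]
  have hle : ‖f c u‖ ≤ ((d + 1 : ℕ) : ℝ) * ‖c‖ := by
    have : ∀ k ∈ (Finset.univ : Finset (Fin (d + 1))), ‖c k * (u : ℂ) ^ (k : ℕ)‖ ≤ ‖c‖ := by
      intro k _
      rw [norm_mul, norm_pow, Complex.norm_real, Real.norm_eq_abs, abs_of_nonneg hu.1]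
      calc ‖c k‖ * u ^ (k : ℕ) ≤ ‖c k‖ * 1 := by gcongr; exact pow_le_one₀ hu.1 hu.2
        _ ≤ ‖c‖ := by rw [mul_one]; exact norm_le_pi_norm c k
    refine (norm_sum_le_of_le _ this).trans ?_
    simp
  calc ‖f c u‖ ^ 2 ≤ (((d + 1 : ℕ) : ℝ) * ‖c‖) ^ 2 := by gcongr
    _ = ((d + 1 : ℕ) : ℝ) ^ 2 / N c₀ * (‖c‖ ^ 2 * N c₀) := by field_simp
    _ ≤ ((d + 1 : ℕ) : ℝ) ^ 2 / N c₀ * N c := by gcongr; exact hscale c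

open Polynomial in
/-- Inverse estimate for polynomials of bounded degree on an arbitrary interval. -/
lemma exists_sup_sq_le_integral (d : ℕ) : ∃ C : ℝ, 0 ≤ C ∧ ∀ p : ℂ[X], p.natDegree ≤ d →
    ∀ a b : ℝ, a < b → ∀ u ∈ Icc a b,
      (b - a) * ‖p.eval (u : ℂ)‖ ^ 2 ≤ C * ∫ t in a..b, ‖p.eval (t : ℂ)‖ ^ 2 := by
  obtain ⟨C, hC, h⟩ := exists_sup_sq_le_integral_unit d
  refine ⟨C, hC, fun p hp a b hab u hu => ?_⟩
  have hba : 0 < b - a := sub_pos.2 hab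
  set q : ℂ[X] := p.comp (Polynomial.C (a : ℂ) + Polynomial.C ((b - a : ℝ) : ℂ) * X) with hq
  have hqd : q.natDegree ≤ d := by
    refine (Polynomial.natDegree_comp_le).trans ?_
    have h1 : (Polynomial.C (a : ℂ) + Polynomial.C ((b - a : ℝ) : ℂ) * X).natDegree ≤ 1 := by
      compute_degree
    calc _ ≤ p.natDegree * 1 := by gcongr
      _ ≤ d := by simpa using hp
  have hqe : ∀ t : ℝ, q.eval (t : ℂ) = p.eval ((a + (b - a) * t : ℝ) : ℂ) := fun t => by
    simp [hq, Polynomial.eval_comp]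
  have h1 := h q hqd ((u - a) / (b - a)) ⟨div_nonneg (sub_nonneg.2 hu.1) hba.le, by
    rw [div_le_one hba]; linarith [hu.2]⟩
  simp only [hqe] at h1
  rw [intervalIntegral.integral_comp_add_mul (fun t : ℝ => ‖p.eval (t : ℂ)‖ ^ 2) hba.ne',
    mul_div_cancel₀ _ hba.ne'] at h1
  simp only [mul_zero, add_zero, mul_one, add_sub_cancel, smul_eq_mul] at h1
  calc (b - a) * ‖p.eval (u : ℂ)‖ ^ 2
      ≤ (b - a) * (C * ((b - a)⁻¹ * ∫ t in a..b, ‖p.eval (t : ℂ)‖ ^ 2)) := by gcongr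
    _ = _ := by field_simp

/-! ### Cells -/

/-- The cell `(j/n, (j+1)/n]`. -/
def cell (n j : ℕ) : Set ℝ := Ioc ((j : ℝ) / n) ((j + 1 : ℝ) / n)

lemma measurableSet_cell (n j : ℕ) : MeasurableSet (cell n j) := measurableSet_Ioc

lemma cell_subset_Ioc {n j : ℕ} (hj : j < n) : cell n j ⊆ Ioc 0 1 := by
  have hn : (0 : ℝ) < n := by exact_mod_cast (Nat.zero_le j).trans_lt hj
  refine Ioc_subset_Ioc (by positivity) ?_
  rw [div_le_one hn]
  exact_mod_cast hj

lemma cell_subset {n j : ℕ} (hj : j < n) : cell n j ⊆ Icc 0 1 :=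
  (cell_subset_Ioc hj).trans Ioc_subset_Icc_self

lemma eq_of_mem_cell {n i j : ℕ} (hn : 0 < n) {t : ℝ} (hi : t ∈ cell n i) (hj : t ∈ cell n j) :
    i = j := by
  have hn' : (0 : ℝ) < n := by exact_mod_cast hn
  simp only [cell, mem_Ioc, div_lt_iff₀ hn', le_div_iff₀ hn'] at hi hj
  have h1 : (i : ℝ) < j + 1 := by linarith
  have h2 : (j : ℝ) < i + 1 := by linarith
  norm_cast at h1 h2
  omega

lemma exists_mem_cell {n : ℕ} (hn : 0 < n) {t : ℝ} (ht : t ∈ Ioc (0 : ℝ) 1) :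
    ∃ j < n, t ∈ cell n j := by
  have hn' : (0 : ℝ) < n := by exact_mod_cast hn
  have hpos : 0 < t * n := mul_pos ht.1 hn'
  have hc : 0 < ⌈t * n⌉₊ := Nat.ceil_pos.2 hpos
  have hle : ⌈t * n⌉₊ ≤ n := Nat.ceil_le.2 (by nlinarith [ht.2])
  have hcast : ((⌈t * n⌉₊ - 1 : ℕ) : ℝ) = (⌈t * n⌉₊ : ℝ) - 1 := by
    rw [Nat.cast_sub hc, Nat.cast_one]
  refine ⟨⌈t * n⌉₊ - 1, by omega, ?_⟩
  simp only [cell, mem_Ioc, div_lt_iff₀ hn', le_div_iff₀ hn', hcast]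
  refine ⟨by linarith [Nat.ceil_lt_add_one hpos.le], by linarith [Nat.le_ceil (t * n)]⟩

lemma ae_mem_Ioc : ∀ᵐ t ∂unitMeasure, t ∈ Ioc (0 : ℝ) 1 := by
  rw [unitMeasure, restrict_Ioc_eq_restrict_Icc.symm]
  exact ae_restrict_mem measurableSet_Ioc

lemma integral_unitMeasure {F : Type*} [NormedAddCommGroup F] [NormedSpace ℝ F] (f : ℝ → F) :
    ∫ t, f t ∂unitMeasure = ∫ t in (0 : ℝ)..1, f t := by
  rw [unitMeasure, integral_Icc_eq_integral_Ioc, intervalIntegral.integral_of_le zero_le_one]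

lemma unitMeasure_restrict_cell {n j : ℕ} (hj : j < n) :
    unitMeasure.restrict (cell n j) = volume.restrict (cell n j) := by
  rw [unitMeasure, Measure.restrict_restrict_of_subset (cell_subset hj)]

lemma integral_eq_sum_cells {n : ℕ} (hn : 0 < n) {f : ℝ → ℂ} (hf : Integrable f unitMeasure) :
    ∫ t, f t ∂unitMeasure = ∑ j ∈ Finset.range n, ∫ t in cell n j, f t := by
  have hn' : (0 : ℝ) < n := by exact_mod_cast hn
  have h01 : IntervalIntegrable f volume 0 1 := by
    rw [intervalIntegrable_iff_integrableOn_Icc_of_le zero_le_one]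
    exact hf
  have hmono : ∀ j : ℕ, (j : ℝ) / n ≤ ((j + 1 : ℕ) : ℝ) / n := fun j => by
    gcongr; simp
  have h := intervalIntegral.sum_integral_adjacent_intervals (μ := volume) (f := f)
    (a := fun j : ℕ => (j : ℝ) / n) (n := n) (fun j hj => by
      refine h01.mono_set ?_
      rw [uIcc_of_le (hmono j), uIcc_of_le zero_le_one]
      refine Icc_subset_Icc (by positivity) ?_
      rw [div_le_one hn']
      exact_mod_cast hj)
  rw [integral_unitMeasure]
  simp only [Nat.cast_zero, zero_div, div_self hn'.ne'] at h
  rw [← h]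
  refine Finset.sum_congr rfl fun j _ => ?_
  rw [intervalIntegral.integral_of_le (hmono j), cell]
  push_cast
  rfl

lemma volume_real_cell {n j : ℕ} (hn : 0 < n) : volume.real (cell n j) = 1 / n := by
  have hn' : (0 : ℝ) < n := by exact_mod_cast hn
  rw [cell, Real.volume_real_Ioc_of_le (by gcongr; simp)]
  field_simp
  ring

lemma norm_setIntegral_cell_le {n j : ℕ} (hn : 0 < n) {f : ℝ → ℂ} {M : ℝ}
    (h : ∀ᵐ t ∂volume.restrict (cell n j), ‖f t‖ ≤ M) :
    ‖∫ t in cell n j, f t‖ ≤ M * (1 / n) := by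
  have : IsFiniteMeasure (volume.restrict (cell n j)) := by rw [cell]; infer_instance
  rw [← volume_real_cell (j := j) hn, ← measureReal_restrict_apply_univ]
  exact norm_integral_le_of_norm_le_const h

lemma ae_restrict_cell {n j : ℕ} (hj : j < n) {p : ℝ → Prop} (h : ∀ᵐ t ∂unitMeasure, p t) :
    ∀ᵐ t ∂volume.restrict (cell n j), p t := by
  rw [← unitMeasure_restrict_cell hj]
  exact ae_restrict_of_ae h

/-! ### The orthogonal projection -/

lemma galerkinProjection_mem (r n : ℕ) (x : LInf) :
    galerkinProjection r n x ∈ piecewisePoly r n :=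
  Submodule.coe_mem _

lemma inclusion_galerkinProjection (r n : ℕ) (x : LInf) :
    inclusion (galerkinProjection r n x)
      = ((piecewisePolyTwo r n).orthogonalProjectionOnto (inclusion x) : LTwo) := by
  have h : ∀ y : piecewisePolyTwo r n,
      inclusion ((piecewisePolyEquiv r n).symm y : LInf) = (y : LTwo) := fun y => by
    conv_rhs => rw [← (piecewisePolyEquiv r n).apply_symm_apply y]
    rfl
  exact h _

lemma galerkinProjection_of_mem {r n : ℕ} {x : LInf} (hx : x ∈ piecewisePoly r n) :
    galerkinProjection r n x = x := by
  refine inclusion_injective ?_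
  rw [inclusion_galerkinProjection]
  have hm : inclusion x ∈ piecewisePolyTwo r n := Submodule.mem_map_of_mem hx
  exact congrArg Subtype.val
    (Submodule.orthogonalProjectionOnto_mem_subspace_eq_self (⟨inclusion x, hm⟩))

lemma coeFn_inclusion (x : LInf) : inclusion x =ᵐ[unitMeasure] x :=
  MemLp.coeFn_toLp ((Lp.memLp x).mono_exponent le_top)

lemma coeFn_cellMonomial (n j k : ℕ) : cellMonomial n j k =ᵐ[unitMeasure]
    (cell n j).indicator fun t : ℝ => (t : ℂ) ^ k :=
  MemLp.coeFn_toLp (memLp_cellMonomial n j k)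

lemma setIntegral_pow_mul_sub_galerkinProjection {r n j k : ℕ} (hj : j < n) (hk : k < 2 * r + 1)
    (x : LInf) :
    ∫ t in cell n j, (t : ℂ) ^ k * (x - galerkinProjection r n x) t = 0 := by
  have hm : inclusion (cellMonomial n j k) ∈ piecewisePolyTwo r n :=
    Submodule.mem_map_of_mem (Submodule.subset_span ⟨(⟨j, hj⟩, ⟨k, hk⟩), rfl⟩)
  have h0 : inner ℂ (inclusion (cellMonomial n j k))
      (inclusion (x - galerkinProjection r n x)) = 0 := by
    rw [map_sub, inclusion_galerkinProjection]
    exact Submodule.sub_starProjection_mem_orthogonal (K := piecewisePolyTwo r n)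
      (inclusion x) _ hm
  rw [L2.inner_def] at h0
  rw [← unitMeasure_restrict_cell hj, ← integral_indicator (measurableSet_cell n j), ← h0]
  refine integral_congr_ae ?_
  filter_upwards [coeFn_inclusion (cellMonomial n j k), coeFn_cellMonomial n j k,
    coeFn_inclusion (x - galerkinProjection r n x)] with t h1 h2 h3
  rw [h1, h2, h3, RCLike.inner_apply]
  by_cases ht : t ∈ cell n j
  · simp [ht, mul_comm]
  · simp [ht]

lemma integrableOn_cell {n j : ℕ} (hj : j < n) {f : ℝ → ℂ} (hf : Integrable f unitMeasure) :
    IntegrableOn f (cell n j) := by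
  rw [IntegrableOn, ← unitMeasure_restrict_cell hj]
  exact hf.restrict

lemma integrable_LInf (x : LInf) : Integrable x unitMeasure :=
  (Lp.memLp x).integrable le_top

lemma integrable_mul_LInf {g : ℝ → ℂ} (hg : ContinuousOn g (Icc 0 1)) (x : LInf) :
    Integrable (fun t => g t * x t) unitMeasure := by
  obtain ⟨M, hM⟩ := isCompact_Icc.exists_bound_of_continuousOn hg
  refine (integrable_LInf x).bdd_mul (hg.aestronglyMeasurable measurableSet_Icc) (c := M) ?_
  filter_upwards [ae_restrict_mem measurableSet_Icc] with t ht using hM t ht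

open Polynomial in
lemma setIntegral_eval_mul_sub_galerkinProjection {r n j : ℕ} (hj : j < n) {p : ℂ[X]}
    (hp : p.natDegree ≤ 2 * r) (x : LInf) :
    ∫ t in cell n j, p.eval (t : ℂ) * (x - galerkinProjection r n x) t = 0 := by
  simp only [Polynomial.eval_eq_sum_range' (Nat.lt_succ_of_le hp), Finset.sum_mul, mul_assoc]
  rw [integral_finsetSum _ fun k _ => ?_]
  · refine Finset.sum_eq_zero fun k hk => ?_
    rw [integral_const_mul, setIntegral_pow_mul_sub_galerkinProjection hj
      (Finset.mem_range.1 hk), mul_zero]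
  · exact (integrableOn_cell hj (integrable_mul_LInf (by fun_prop) _)).const_mul _

lemma coeFn_sum_cellMonomial {r n : ℕ} (hn : 0 < n) (a : Fin n × Fin (2 * r + 1) → ℂ) :
    ∀ᵐ t ∂unitMeasure, ∀ j : Fin n, t ∈ cell n j →
      (∑ p, a p • cellMonomial n p.1 p.2 : LInf) t = ∑ k, a (j, k) * (t : ℂ) ^ (k : ℕ) := by
  have h1 : ∀ s : Finset (Fin n × Fin (2 * r + 1)), ∀ᵐ t ∂unitMeasure,
      (∑ p ∈ s, a p • cellMonomial n p.1 p.2 : LInf) t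
        = ∑ p ∈ s, a p * (cell n p.1).indicator (fun t : ℝ => (t : ℂ) ^ (p.2 : ℕ)) t := by
    intro s
    induction s using Finset.induction_on with
    | empty =>
      exact Filter.Eventually.of_forall fun t => by simp
    | insert p s hp ih =>
      rw [Finset.sum_insert hp]
      filter_upwards [ih, Lp.coeFn_add (a p • cellMonomial n p.1 p.2)
        (∑ p ∈ s, a p • cellMonomial n p.1 p.2), Lp.coeFn_smul (a p) (cellMonomial n p.1 p.2),
        coeFn_cellMonomial n p.1 p.2] with t h1 h2 h3 h4
      rw [h2, Pi.add_apply, h1, h3, Pi.smul_apply, h4, Finset.sum_insert hp, smul_eq_mul]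
  filter_upwards [h1 Finset.univ] with t ht j hj
  rw [ht, Fintype.sum_prod_type, Finset.sum_eq_single j]
  · simp [hj]
  · intro i _ hij
    refine Finset.sum_eq_zero fun k _ => ?_
    rw [indicator_of_notMem, mul_zero]
    exact fun hi => hij (Fin.ext (eq_of_mem_cell hn hi hj))
  · simp

open Polynomial in
lemma exists_eval_of_mem_piecewisePoly {r n : ℕ} (hn : 0 < n) {q : LInf}
    (hq : q ∈ piecewisePoly r n) : ∃ c : ℕ → ℂ[X], (∀ j, (c j).natDegree ≤ 2 * r) ∧
      ∀ᵐ t ∂unitMeasure, ∀ j < n, t ∈ cell n j → q t = (c j).eval (t : ℂ) := by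
  obtain ⟨a, rfl⟩ := (Submodule.mem_span_range_iff_exists_fun ℂ).1 hq
  refine ⟨fun j => if hj : j < n then
    ∑ k : Fin (2 * r + 1), Polynomial.monomial k (a (⟨j, hj⟩, k)) else 0, fun j => ?_, ?_⟩
  · dsimp only
    split_ifs
    · refine Polynomial.natDegree_sum_le_of_forall_le _ _ fun k _ => ?_
      exact (Polynomial.natDegree_monomial_le _).trans (Nat.le_of_lt_succ k.2)
    · simp
  · filter_upwards [coeFn_sum_cellMonomial hn a] with t ht j hj htj
    rw [ht ⟨j, hj⟩ htj, dif_pos hj, Polynomial.eval_finsetSum]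
    simp

open Polynomial in
lemma exists_mem_piecewisePoly_of_eval {r n : ℕ} (hn : 0 < n) {c : ℕ → ℂ[X]}
    (hc : ∀ j < n, (c j).natDegree ≤ 2 * r) : ∃ q ∈ piecewisePoly r n,
      ∀ᵐ t ∂unitMeasure, ∀ j < n, t ∈ cell n j → q t = (c j).eval (t : ℂ) := by
  refine ⟨∑ p : Fin n × Fin (2 * r + 1), (c p.1).coeff p.2 • cellMonomial n p.1 p.2,
    (Submodule.mem_span_range_iff_exists_fun ℂ).2 ⟨fun p => (c p.1).coeff p.2, rfl⟩, ?_⟩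
  filter_upwards [coeFn_sum_cellMonomial hn fun p : Fin n × Fin (2 * r + 1) =>
    (c p.1).coeff p.2] with t ht j hj htj
  rw [ht ⟨j, hj⟩ htj, Polynomial.eval_eq_sum_range' (Nat.lt_succ_of_le (hc j hj)),
    ← Fin.sum_univ_eq_sum_range fun k => (c j).coeff k * (t : ℂ) ^ k]

lemma norm_le_of_ae_cells {n : ℕ} (hn : 0 < n) {y : LInf} {M : ℝ} (hM : 0 ≤ M)
    (h : ∀ᵐ t ∂unitMeasure, ∀ j < n, t ∈ cell n j → ‖y t‖ ≤ M) : ‖y‖ ≤ M := by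
  have := Lp.norm_le_of_ae_bound (f := y) hM (by
    filter_upwards [h, ae_mem_Ioc] with t h1 h2
    obtain ⟨j, hj, hjt⟩ := exists_mem_cell hn h2
    exact h1 j hj hjt)
  simpa using this

open Polynomial in
/-- The projections `Pₙ` are uniformly bounded on `L^∞`. -/
lemma exists_norm_galerkinProjection_le (r : ℕ) : ∃ C : ℝ, 0 ≤ C ∧ ∀ n : ℕ, 0 < n → ∀ x : LInf,
    ‖galerkinProjection r n x‖ ≤ C * ‖x‖ := by
  obtain ⟨C, hC, hinv⟩ := exists_sup_sq_le_integral (2 * r)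
  refine ⟨C, hC, fun n hn x => ?_⟩
  have hn' : (0 : ℝ) < n := by exact_mod_cast hn
  obtain ⟨c, hc, hq⟩ := exists_eval_of_mem_piecewisePoly hn (galerkinProjection_mem r n x)
  refine norm_le_of_ae_cells hn (by positivity) ?_
  filter_upwards [hq] with t ht j hj htj
  rw [ht j hj htj]
  set p := c j
  set a : ℝ := (j : ℝ) / n
  set b : ℝ := (j + 1 : ℝ) / n
  have hba : b - a = 1 / n := by simp only [a, b]; field_simp; ring
  have hab : a < b := by rw [← sub_pos, hba]; positivity
  have hpc : Continuous fun t : ℝ => p.eval (t : ℂ) := by fun_prop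
  -- Let M be the maximum of |p| on the closed cell. Testing orthogonality with the conjugate of p
  -- gives ∫|p|² ≤ M‖x‖/n, while the inverse estimate gives M²/n ≤ C∫|p|². Cancelling one factor M
  -- leaves M ≤ C‖x‖.
  obtain ⟨u, hu, hmax⟩ := isCompact_Icc.exists_isMaxOn (nonempty_Icc.2 hab.le)
    hpc.norm.continuousOn
  set M := ‖p.eval (u : ℂ)‖
  have hle : ‖p.eval (t : ℂ)‖ ≤ M := hmax (Ioc_subset_Icc_self htj)
  refine hle.trans ?_
  have h1 := hinv p (hc j) a b hab u hu
  have h2 : ((∫ t in a..b, ‖p.eval (t : ℂ)‖ ^ 2 : ℝ) : ℂ)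
      = ∫ t in cell n j, (p.map (starRingEnd ℂ)).eval (t : ℂ) * x t := by
    have h3 := setIntegral_eval_mul_sub_galerkinProjection hj
      (p := p.map (starRingEnd ℂ)) ((Polynomial.natDegree_map_le).trans (hc j)) x
    -- At real points, conjugating the coefficients conjugates the value, so the conjugate of p is
    -- again an admissible test polynomial.
    have hconj : ∀ t : ℝ, (p.map (starRingEnd ℂ)).eval (t : ℂ) = star (p.eval (t : ℂ)) :=
      fun t => by
      rw [Polynomial.eval_map, ← Complex.conj_ofReal t, Polynomial.eval₂_hom]
      simp
    have hcont : Continuous fun t : ℝ => (p.map (starRingEnd ℂ)).eval (t : ℂ) := by fun_prop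
    have h4 : ∫ t in cell n j,
          (p.map (starRingEnd ℂ)).eval (t : ℂ) * (x - galerkinProjection r n x) t
        = (∫ t in cell n j, (p.map (starRingEnd ℂ)).eval (t : ℂ) * x t)
          - ∫ t in cell n j, ((‖p.eval (t : ℂ)‖ ^ 2 : ℝ) : ℂ) := by
      rw [← integral_sub (integrableOn_cell hj (integrable_mul_LInf hcont.continuousOn _))]
      · refine integral_congr_ae ?_
        filter_upwards [ae_restrict_cell hj hq, ae_restrict_mem (measurableSet_cell n j),
          ae_restrict_cell hj (Lp.coeFn_sub x (galerkinProjection r n x))] with t k1 k2 k3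
        rw [k3, Pi.sub_apply, mul_sub, k1 j hj k2, hconj]
        congr 1
        rw [Complex.star_def, ← Complex.normSq_eq_conj_mul_self, Complex.normSq_eq_norm_sq]
      · exact (by fun_prop :
          Continuous fun t : ℝ => ((‖p.eval (t : ℂ)‖ ^ 2 : ℝ) : ℂ)).integrableOn_Ioc
    rw [h3] at h4
    rw [sub_eq_zero.1 h4.symm, intervalIntegral.integral_of_le hab.le, ← integral_complex_ofReal]
    rfl
  have h5 : ∫ t in a..b, ‖p.eval (t : ℂ)‖ ^ 2 ≤ M * ‖x‖ * (1 / n) := by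
    have h6 : ‖∫ t in cell n j, (p.map (starRingEnd ℂ)).eval (t : ℂ) * x t‖
        ≤ M * ‖x‖ * (1 / n) := by
      refine norm_setIntegral_cell_le hn ?_
      filter_upwards [ae_restrict_cell hj (ae_norm_le x),
        ae_restrict_mem (measurableSet_cell n j)] with t k1 k2
      rw [norm_mul]
      gcongr
      have : ‖(p.map (starRingEnd ℂ)).eval (t : ℂ)‖ = ‖p.eval (t : ℂ)‖ := by
        rw [Polynomial.eval_map, ← Complex.conj_ofReal t, Polynomial.eval₂_hom]
        simp
      rw [this]
      exact hmax (Ioc_subset_Icc_self k2)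
    rw [← h2, Complex.norm_real] at h6
    exact (le_abs_self _).trans h6
  rw [hba] at h1
  have hM0 : 0 ≤ M := norm_nonneg _
  rcases hM0.eq_or_lt with h0 | h0
  · rw [← h0]; positivity
  · have h7 : 1 / (n : ℝ) * M ^ 2 ≤ C * (M * ‖x‖ * (1 / n)) := h1.trans (by gcongr)
    have h8 : (1 / (n : ℝ) * M) * M ≤ (1 / (n : ℝ) * M) * (C * ‖x‖) := by linarith
    exact le_of_mul_le_mul_left h8 (by positivity)

open Polynomial in
/-- The projection error is controlled by the cellwise distance to polynomials. -/
lemma exists_norm_sub_galerkinProjection_le (r : ℕ) : ∃ C : ℝ, 1 ≤ C ∧ ∀ n : ℕ, 0 < n →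
    (∀ x : LInf, ‖x - galerkinProjection r n x‖ ≤ C * ‖x‖) ∧
    ∀ x : LInf, ∀ ε : ℝ, 0 ≤ ε → (∀ j < n, ∃ p : ℂ[X], p.natDegree ≤ 2 * r ∧
      ∀ᵐ t ∂unitMeasure, t ∈ cell n j → ‖x t - p.eval (t : ℂ)‖ ≤ ε) →
      ‖x - galerkinProjection r n x‖ ≤ C * ε := by
  obtain ⟨C, hC, hP⟩ := exists_norm_galerkinProjection_le r
  have hbd : ∀ n : ℕ, 0 < n → ∀ x : LInf, ‖x - galerkinProjection r n x‖ ≤ (1 + C) * ‖x‖ :=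
    fun n hn x => by
    refine (norm_sub_le _ _).trans ?_
    linarith [hP n hn x]
  refine ⟨1 + C, by linarith, fun n hn => ⟨hbd n hn, fun x ε hε h => ?_⟩⟩
  choose! c hc hcx using h
  obtain ⟨q, hq, hqc⟩ := exists_mem_piecewisePoly_of_eval hn hc
  -- The projection fixes q, so uniform boundedness turns any approximation by 𝒳ₙ into a bound of
  -- the projection error.
  have h1 : x - galerkinProjection r n x = (x - q) - galerkinProjection r n (x - q) := by
    rw [map_sub, galerkinProjection_of_mem hq]; abel
  rw [h1]
  refine (hbd n hn _).trans ?_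
  gcongr
  refine norm_le_of_ae_cells hn hε ?_
  have hcx' : ∀ᵐ t ∂unitMeasure, ∀ j < n, t ∈ cell n j → ‖x t - (c j).eval (t : ℂ)‖ ≤ ε := by
    rw [ae_all_iff]
    intro j
    by_cases hj : j < n
    · filter_upwards [hcx j hj] with t ht _ using ht
    · exact Filter.Eventually.of_forall fun t h => absurd h hj
  filter_upwards [hqc, hcx', Lp.coeFn_sub x q] with t k1 k2 k3 j hj htj
  rw [k3, Pi.sub_apply, k1 j hj htj]
  exact k2 j hj htj

/-! ### Smooth functions on planar convex sets and on the two triangles -/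

section Planar

variable {T : Set (ℝ × ℝ)} {g : ℝ × ℝ → ℂ}

/-- The derivative within `T` in the direction `v`. -/
def dirDeriv (T : Set (ℝ × ℝ)) (g : ℝ × ℝ → ℂ) (v p : ℝ × ℝ) : ℂ := fderivWithin ℝ g T p v

lemma contDiffOn_dirDeriv (hT : UniqueDiffOn ℝ T) {k : ℕ}
    (hg : ContDiffOn ℝ ((k + 1 : ℕ) : WithTop ℕ∞) g T) (v : ℝ × ℝ) :
    ContDiffOn ℝ (k : WithTop ℕ∞) (dirDeriv T g v) T :=
  (hg.fderivWithin hT (by push_cast; rfl)).clm_apply contDiffOn_const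

lemma hasDerivWithinAt_slice_snd (hg : DifferentiableOn ℝ g T) {s t : ℝ} (h : (s, t) ∈ T)
    {I : Set ℝ} (hI : ∀ u ∈ I, (s, u) ∈ T) :
    HasDerivWithinAt (fun u => g (s, u)) (dirDeriv T g (0, 1) (s, t)) I t :=
  HasFDerivWithinAt.comp_hasDerivWithinAt (f := fun u => (s, u)) t (hg _ h).hasFDerivWithinAt
    ((hasDerivWithinAt_const t I s).prodMk (hasDerivWithinAt_id t I)) hI

lemma hasDerivWithinAt_slice_fst (hg : DifferentiableOn ℝ g T) {s t : ℝ} (h : (s, t) ∈ T)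
    {I : Set ℝ} (hI : ∀ u ∈ I, (u, t) ∈ T) :
    HasDerivWithinAt (fun u => g (u, t)) (dirDeriv T g (1, 0) (s, t)) I s :=
  HasFDerivWithinAt.comp_hasDerivWithinAt (f := fun u => (u, t)) s (hg _ h).hasFDerivWithinAt
    ((hasDerivWithinAt_id s I).prodMk (hasDerivWithinAt_const s I t)) hI

lemma exists_lipschitz_of_contDiffOn (hc : IsCompact T) (hconv : Convex ℝ T)
    (hT : UniqueDiffOn ℝ T) (hg : ContDiffOn ℝ 1 g T) :
    ∃ M : ℝ, 0 ≤ M ∧ ∀ p ∈ T, ∀ q ∈ T, ‖g p - g q‖ ≤ M * ‖p - q‖ := by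
  obtain ⟨M, hM⟩ := hc.exists_bound_of_continuousOn (hg.continuousOn_fderivWithin hT le_rfl)
  refine ⟨max M 0, le_max_right _ _, fun p hp q hq => ?_⟩
  exact hconv.norm_image_sub_le_of_norm_fderivWithin_le (hg.differentiableOn one_ne_zero)
    (fun x hx => (hM x hx).trans (le_max_left _ _)) hq hp

lemma mem_of_mem_uIcc_snd (hconv : Convex ℝ T) {s t t' u : ℝ} (h : (s, t) ∈ T) (h' : (s, t') ∈ T)
    (hu : u ∈ uIcc t t') : (s, u) ∈ T := by
  rw [← segment_eq_uIcc] at hu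
  obtain ⟨a, b, ha, hb, hab, rfl⟩ := hu
  have := hconv h h' ha hb hab
  convert this using 1
  simp [← add_mul, hab]

/-- Lipschitz bound, first-order Taylor bound in the second variable and bound of the mixed second
difference of a `C²` function on a compact convex set. -/
lemma exists_second_order_bounds (hc : IsCompact T) (hconv : Convex ℝ T)
    (hT : UniqueDiffOn ℝ T) (hg : ContDiffOn ℝ 2 g T) :
    ∃ M : ℝ, 0 ≤ M ∧ (∀ p ∈ T, ∀ q ∈ T, ‖g p - g q‖ ≤ M * ‖p - q‖) ∧
      (∀ s t₀ t : ℝ, (s, t₀) ∈ T → (s, t) ∈ T →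
        ‖g (s, t) - g (s, t₀) - ((t - t₀ : ℝ) : ℂ) * dirDeriv T g (0, 1) (s, t₀)‖
          ≤ M * |t - t₀| ^ 2) ∧
      (∀ s s' t t' : ℝ, (s, t) ∈ T → (s, t') ∈ T → (s', t) ∈ T → (s', t') ∈ T →
        ‖(g (s, t') - g (s', t')) - (g (s, t) - g (s', t))‖ ≤ M * |s - s'| * |t' - t|) := by
  have hg1 : ContDiffOn ℝ 1 g T := hg.of_le (by norm_num)
  have hgd : DifferentiableOn ℝ g T := hg.differentiableOn two_ne_zero
  have hg' : ContDiffOn ℝ 1 (dirDeriv T g (0, 1)) T :=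
    contDiffOn_dirDeriv (k := 1) hT (by exact_mod_cast hg) (0, 1)
  obtain ⟨M₁, hM₁, h1⟩ := exists_lipschitz_of_contDiffOn hc hconv hT hg1
  obtain ⟨M₂, hM₂, h2⟩ := exists_lipschitz_of_contDiffOn hc hconv hT hg'
  refine ⟨M₁ + M₂, by positivity, fun p hp q hq => (h1 p hp q hq).trans ?_,
    fun s t₀ t h0 ht => ?_, fun s s' t t' h3 h4 h5 h6 => ?_⟩
  · gcongr; linarith
  · have hmem : ∀ u ∈ uIcc t₀ t, (s, u) ∈ T := fun u hu => mem_of_mem_uIcc_snd hconv h0 ht hu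
    -- Once the tangent is subtracted, the derivative is a difference of values of ∂ₜg, which is
    -- Lipschitz because g is C². The mixed difference below rests on the same Lipschitz bound,
    -- taken in the first variable.
    have hd : ∀ u ∈ uIcc t₀ t, HasDerivWithinAt
        (fun u => g (s, u) - ((u - t₀ : ℝ) : ℂ) * dirDeriv T g (0, 1) (s, t₀))
        (dirDeriv T g (0, 1) (s, u) - dirDeriv T g (0, 1) (s, t₀)) (uIcc t₀ t) u := fun u hu => by
      refine (hasDerivWithinAt_slice_snd hgd (hmem u hu) hmem).sub ?_
      have := (((hasDerivWithinAt_id u (uIcc t₀ t)).sub_const t₀).ofReal_comp).mul_const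
        (dirDeriv T g (0, 1) (s, t₀))
      simpa using this
    have := (convex_uIcc t₀ t).norm_image_sub_le_of_norm_hasDerivWithin_le hd
      (C := M₂ * |t - t₀|) (fun u hu => (h2 _ (hmem u hu) _ h0).trans (by
        gcongr
        simp only [Prod.mk_sub_mk, sub_self, Prod.norm_mk, norm_zero, Real.norm_eq_abs]
        rw [max_eq_right (abs_nonneg _)]
        exact abs_sub_left_of_mem_uIcc hu)) left_mem_uIcc right_mem_uIcc
    simp only [sub_self, Complex.ofReal_zero, zero_mul, sub_zero] at this
    rw [sub_right_comm]
    refine this.trans ?_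
    rw [Real.norm_eq_abs]
    calc _ = M₂ * |t - t₀| ^ 2 := by ring
      _ ≤ _ := by gcongr; linarith
  · have hm : ∀ u ∈ uIcc t t', (s, u) ∈ T := fun u hu => mem_of_mem_uIcc_snd hconv h3 h4 hu
    have hm' : ∀ u ∈ uIcc t t', (s', u) ∈ T := fun u hu => mem_of_mem_uIcc_snd hconv h5 h6 hu
    have := (convex_uIcc t t').norm_image_sub_le_of_norm_hasDerivWithin_le
      (f := fun u => g (s, u) - g (s', u)) (C := M₂ * |s - s'|)
      (fun u hu => (hasDerivWithinAt_slice_snd hgd (hm u hu) hm).sub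
        (hasDerivWithinAt_slice_snd hgd (hm' u hu) hm'))
      (fun u hu => (h2 _ (hm u hu) _ (hm' u hu)).trans (by
        gcongr
        simp)) left_mem_uIcc right_mem_uIcc
    refine this.trans ?_
    rw [Real.norm_eq_abs]
    gcongr
    linarith

end Planar

lemma convex_lowerTriangle : Convex ℝ lowerTriangle := by
  rintro ⟨s, t⟩ ⟨h1, h2, h3⟩ ⟨s', t'⟩ ⟨h1', h2', h3'⟩ a b ha hb hab
  simp only at h1 h2 h3 h1' h2' h3'
  refine ⟨?_, ?_, ?_⟩ <;> simp only [Prod.smul_mk, Prod.mk_add_mk, smul_eq_mul]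
  · positivity
  · gcongr
  · calc a * s + b * s' ≤ a * 1 + b * 1 := by gcongr
      _ = 1 := by linarith

lemma convex_upperTriangle : Convex ℝ upperTriangle := by
  rintro ⟨s, t⟩ ⟨h1, h2, h3⟩ ⟨s', t'⟩ ⟨h1', h2', h3'⟩ a b ha hb hab
  simp only at h1 h2 h3 h1' h2' h3'
  refine ⟨?_, ?_, ?_⟩ <;> simp only [Prod.smul_mk, Prod.mk_add_mk, smul_eq_mul]
  · positivity
  · gcongr
  · calc a * t + b * t' ≤ a * 1 + b * 1 := by gcongr
      _ = 1 := by linarith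

lemma isCompact_lowerTriangle : IsCompact lowerTriangle := by
  refine (isCompact_Icc.prod isCompact_Icc :
    IsCompact (Icc (0 : ℝ) 1 ×ˢ Icc (0 : ℝ) 1)).of_isClosed_subset ?_ ?_
  · have : lowerTriangle = {p : ℝ × ℝ | 0 ≤ p.2} ∩ ({p | p.2 ≤ p.1} ∩ {p | p.1 ≤ 1}) := rfl
    rw [this]
    exact (isClosed_le (by fun_prop) (by fun_prop)).inter
      ((isClosed_le (by fun_prop) (by fun_prop)).inter (isClosed_le (by fun_prop) (by fun_prop)))
  · rintro ⟨s, t⟩ ⟨h1, h2, h3⟩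
    exact ⟨⟨h1.trans h2, h3⟩, ⟨h1, h2.trans h3⟩⟩

lemma isCompact_upperTriangle : IsCompact upperTriangle := by
  refine (isCompact_Icc.prod isCompact_Icc :
    IsCompact (Icc (0 : ℝ) 1 ×ˢ Icc (0 : ℝ) 1)).of_isClosed_subset ?_ ?_
  · have : upperTriangle = {p : ℝ × ℝ | 0 ≤ p.1} ∩ ({p | p.1 ≤ p.2} ∩ {p | p.2 ≤ 1}) := rfl
    rw [this]
    exact (isClosed_le (by fun_prop) (by fun_prop)).inter
      ((isClosed_le (by fun_prop) (by fun_prop)).inter (isClosed_le (by fun_prop) (by fun_prop)))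
  · rintro ⟨s, t⟩ ⟨h1, h2, h3⟩
    exact ⟨⟨h1, h2.trans h3⟩, ⟨h1.trans h2, h3⟩⟩

lemma uniqueDiffOn_lowerTriangle : UniqueDiffOn ℝ lowerTriangle := by
  refine uniqueDiffOn_convex convex_lowerTriangle ⟨(3 / 4, 1 / 4), ?_⟩
  rw [mem_interior]
  refine ⟨{p | 0 < p.2} ∩ ({p | p.2 < p.1} ∩ {p | p.1 < 1}), fun p hp =>
    ⟨hp.1.le, hp.2.1.le, hp.2.2.le⟩, ?_, ?_⟩
  · exact (isOpen_lt (by fun_prop) (by fun_prop)).inter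
      ((isOpen_lt (by fun_prop) (by fun_prop)).inter (isOpen_lt (by fun_prop) (by fun_prop)))
  · refine ⟨?_, ?_, ?_⟩ <;> simp only [mem_ofPred_eq] <;> norm_num

lemma uniqueDiffOn_upperTriangle : UniqueDiffOn ℝ upperTriangle := by
  refine uniqueDiffOn_convex convex_upperTriangle ⟨(1 / 4, 3 / 4), ?_⟩
  rw [mem_interior]
  refine ⟨{p | 0 < p.1} ∩ ({p | p.1 < p.2} ∩ {p | p.2 < 1}), fun p hp =>
    ⟨hp.1.le, hp.2.1.le, hp.2.2.le⟩, ?_, ?_⟩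
  · exact (isOpen_lt (by fun_prop) (by fun_prop)).inter
      ((isOpen_lt (by fun_prop) (by fun_prop)).inter (isOpen_lt (by fun_prop) (by fun_prop)))
  · refine ⟨?_, ?_, ?_⟩ <;> simp only [mem_ofPred_eq] <;> norm_num

/-! ### Estimates for the Green's kernel across and away from the diagonal -/

namespace GreenKernel

variable {α : ℕ} (κ : GreenKernel α)

lemma contDiffOn_kernel_lowerTriangle :
    ContDiffOn ℝ α (fun p : ℝ × ℝ => (κ.kernel p.1 p.2 : ℂ)) lowerTriangle := by
  refine Complex.ofRealCLM.contDiff.comp_contDiffOn (κ.contDiffOn_lower.congr ?_)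
  rintro ⟨s, t⟩ ⟨_, h, _⟩
  exact if_pos h

lemma contDiffOn_kernel_upperTriangle :
    ContDiffOn ℝ α (fun p : ℝ × ℝ => (κ.kernel p.1 p.2 : ℂ)) upperTriangle := by
  refine Complex.ofRealCLM.contDiff.comp_contDiffOn (κ.contDiffOn_upper.congr ?_)
  rintro ⟨s, t⟩ ⟨h0, h, h'⟩
  simp only at h0 h h'
  rcases h.lt_or_eq with h | rfl
  · exact if_neg (not_le.2 h)
  · exact (if_pos le_rfl).trans (κ.diag s ⟨h0, h'⟩)

/-- Glues Lipschitz bounds of the two kernel branches by passing through the diagonal point c, where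
the derivative may jump. -/
lemma norm_sub_le_of_halves {f : ℝ → ℂ} {c M : ℝ}
    (h1 : ∀ x y : ℝ, x ∈ Icc (0 : ℝ) c → y ∈ Icc (0 : ℝ) c → ‖f x - f y‖ ≤ M * |x - y|)
    (h2 : ∀ x y : ℝ, x ∈ Icc c 1 → y ∈ Icc c 1 → ‖f x - f y‖ ≤ M * |x - y|) :
    ∀ x ∈ Icc (0 : ℝ) 1, ∀ y ∈ Icc (0 : ℝ) 1, ‖f x - f y‖ ≤ M * |x - y| := by
  have key : ∀ x ∈ Icc (0 : ℝ) 1, ∀ y ∈ Icc (0 : ℝ) 1, x ≤ y → ‖f x - f y‖ ≤ M * |x - y| := by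
    intro x hx y hy hxy
    rcases le_total y c with h | h
    · exact h1 x y ⟨hx.1, hxy.trans h⟩ ⟨hy.1, h⟩
    rcases le_total c x with h' | h'
    · exact h2 x y ⟨h', hx.2⟩ ⟨h, hy.2⟩
    have k1 := h1 x c ⟨hx.1, h'⟩ ⟨hx.1.trans h', le_rfl⟩
    have k2 := h2 c y ⟨le_rfl, h.trans hy.2⟩ ⟨h, hy.2⟩
    have k3 := norm_sub_le_norm_sub_add_norm_sub (f x) (f c) (f y)
    rw [abs_of_nonpos (by linarith)] at k1 k2 ⊢
    linarith
  intro x hx y hy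
  rcases le_total x y with h | h
  · exact key x hx y hy h
  · rw [norm_sub_rev, abs_sub_comm]
    exact key y hy x hx h

/-- The kernel estimates used for the Galerkin scheme: global Lipschitz continuity, and away from
the diagonal affine approximation and a bound of the mixed second difference. -/
lemma exists_kernel_bounds (hα : 2 ≤ α) : ∃ M : ℝ, 0 ≤ M ∧
    (∀ t ∈ Icc (0 : ℝ) 1, ∀ s ∈ Icc (0 : ℝ) 1, ∀ s' ∈ Icc (0 : ℝ) 1,
      ‖(κ.kernel s t : ℂ) - κ.kernel s' t‖ ≤ M * |s - s'|) ∧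
    (∀ s ∈ Icc (0 : ℝ) 1, ∀ t ∈ Icc (0 : ℝ) 1, ∀ t' ∈ Icc (0 : ℝ) 1,
      ‖(κ.kernel s t : ℂ) - κ.kernel s t'‖ ≤ M * |t - t'|) ∧
    (∀ a b s : ℝ, 0 ≤ a → a ≤ b → b ≤ 1 → s ∈ Icc (0 : ℝ) 1 → (s ≤ a ∨ b ≤ s) →
      ∃ A B : ℂ, ∀ t ∈ Icc a b, ‖(κ.kernel s t : ℂ) - (A + B * t)‖ ≤ M * (b - a) ^ 2) ∧
    (∀ a b s s' : ℝ, 0 ≤ a → b ≤ 1 → s ∈ Icc (0 : ℝ) 1 → s' ∈ Icc (0 : ℝ) 1 →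
      (s ≤ a ∧ s' ≤ a ∨ b ≤ s ∧ b ≤ s') → ∀ t ∈ Icc a b, ∀ t' ∈ Icc a b,
      ‖((κ.kernel s t' : ℂ) - κ.kernel s' t') - (κ.kernel s t - κ.kernel s' t)‖
        ≤ M * |s - s'| * |t' - t|) := by
  have h2 : (2 : WithTop ℕ∞) ≤ (α : WithTop ℕ∞) := by exact_mod_cast hα
  obtain ⟨L, hL, l1, l2, l3⟩ := exists_second_order_bounds isCompact_lowerTriangle
    convex_lowerTriangle uniqueDiffOn_lowerTriangle (κ.contDiffOn_kernel_lowerTriangle.of_le h2)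
  obtain ⟨U, hU, u1, u2, u3⟩ := exists_second_order_bounds isCompact_upperTriangle
    convex_upperTriangle uniqueDiffOn_upperTriangle (κ.contDiffOn_kernel_upperTriangle.of_le h2)
  set gL := dirDeriv lowerTriangle (fun p : ℝ × ℝ => (κ.kernel p.1 p.2 : ℂ)) (0, 1)
  set gU := dirDeriv upperTriangle (fun p : ℝ × ℝ => (κ.kernel p.1 p.2 : ℂ)) (0, 1)
  have hLM : L ≤ L + U := by linarith
  have hUM : U ≤ L + U := by linarith
  refine ⟨L + U, by positivity, fun t ht => ?_, fun s hs => ?_, ?_, ?_⟩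
  · refine norm_sub_le_of_halves (c := t) (fun x y hx hy => ?_) (fun x y hx hy => ?_)
    · refine (u1 (x, t) ⟨hx.1, hx.2, ht.2⟩ (y, t) ⟨hy.1, hy.2, ht.2⟩).trans ?_
      simp only [Prod.mk_sub_mk, sub_self, Prod.norm_mk, norm_zero, Real.norm_eq_abs]
      rw [max_eq_left (abs_nonneg _)]
      gcongr
    · refine (l1 (x, t) ⟨ht.1, hx.1, hx.2⟩ (y, t) ⟨ht.1, hy.1, hy.2⟩).trans ?_
      simp only [Prod.mk_sub_mk, sub_self, Prod.norm_mk, norm_zero, Real.norm_eq_abs]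
      rw [max_eq_left (abs_nonneg _)]
      gcongr
  · refine norm_sub_le_of_halves (c := s) (fun x y hx hy => ?_) (fun x y hx hy => ?_)
    · refine (l1 (s, x) ⟨hx.1, hx.2, hs.2⟩ (s, y) ⟨hy.1, hy.2, hs.2⟩).trans ?_
      simp only [Prod.mk_sub_mk, sub_self, Prod.norm_mk, norm_zero, Real.norm_eq_abs]
      rw [max_eq_right (abs_nonneg _)]
      gcongr
    · refine (u1 (s, x) ⟨hs.1, hx.1, hx.2⟩ (s, y) ⟨hs.1, hy.1, hy.2⟩).trans ?_
      simp only [Prod.mk_sub_mk, sub_self, Prod.norm_mk, norm_zero, Real.norm_eq_abs]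
      rw [max_eq_right (abs_nonneg _)]
      gcongr
  · intro a b s ha hab hb hs hsab
    have hsq : ∀ t ∈ Icc a b, |t - a| ^ 2 ≤ (b - a) ^ 2 := fun t ht => by
      rw [abs_of_nonneg (sub_nonneg.2 ht.1)]
      have := sub_nonneg.2 ht.1
      gcongr
      exact ht.2
    rcases hsab with h | h
    -- A + Bt is the first-order Taylor polynomial of κ(s,·) at the left endpoint a.
    · refine ⟨κ.kernel s a - a * gU (s, a), gU (s, a), fun t ht => ?_⟩
      have := u2 s a t ⟨hs.1, h, hab.trans hb⟩ ⟨hs.1, h.trans ht.1, ht.2.trans hb⟩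
      rw [show (κ.kernel s t : ℂ) - (κ.kernel s a - a * gU (s, a) + gU (s, a) * t)
        = κ.kernel s t - κ.kernel s a - ((t - a : ℝ) : ℂ) * gU (s, a) by push_cast; ring]
      refine this.trans ?_
      gcongr ?_ * ?_
      exact hsq t ht
    · refine ⟨κ.kernel s a - a * gL (s, a), gL (s, a), fun t ht => ?_⟩
      have := l2 s a t ⟨ha, hab.trans h, hs.2⟩ ⟨ha.trans ht.1, ht.2.trans h, hs.2⟩
      rw [show (κ.kernel s t : ℂ) - (κ.kernel s a - a * gL (s, a) + gL (s, a) * t)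
        = κ.kernel s t - κ.kernel s a - ((t - a : ℝ) : ℂ) * gL (s, a) by push_cast; ring]
      refine this.trans ?_
      gcongr ?_ * ?_
      exact hsq t ht
  · intro a b s s' ha hb hs hs' hss t ht t' ht'
    rcases hss with ⟨h, h'⟩ | ⟨h, h'⟩
    · refine (u3 s s' t t' ⟨hs.1, h.trans ht.1, ht.2.trans hb⟩ ⟨hs.1, h.trans ht'.1, ht'.2.trans hb⟩
        ⟨hs'.1, h'.trans ht.1, ht.2.trans hb⟩ ⟨hs'.1, h'.trans ht'.1, ht'.2.trans hb⟩).trans ?_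
      gcongr
    · refine (l3 s s' t t' ⟨ha.trans ht.1, ht.2.trans h, hs.2⟩ ⟨ha.trans ht'.1, ht'.2.trans h, hs.2⟩
        ⟨ha.trans ht.1, ht.2.trans h', hs'.2⟩ ⟨ha.trans ht'.1, ht'.2.trans h', hs'.2⟩).trans ?_
      gcongr

end GreenKernel

/-! ### Smoothness of Volterra integrals -/

/-- The Volterra integral `∫₀ˢ g(s,t) f(t) dt`. -/
def volterra (g : ℝ × ℝ → ℂ) (f : ℝ → ℂ) (s : ℝ) : ℂ := ∫ t in (0 : ℝ)..s, g (s, t) * f t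

lemma continuousOn_mul_comp_snd {g : ℝ × ℝ → ℂ} {f : ℝ → ℂ} (hg : ContinuousOn g lowerTriangle)
    (hf : ContinuousOn f (Icc 0 1)) : ContinuousOn (fun p => g p * f p.2) lowerTriangle :=
  hg.mul (hf.comp continuous_snd.continuousOn fun _ hp => ⟨hp.1, hp.2.1.trans hp.2.2⟩)

/-- The substitution t = su moves the integral to the fixed interval [0,1] with (s, su) still in the
triangle, so dominated convergence applies. -/
lemma continuousOn_volterra {g : ℝ × ℝ → ℂ} {f : ℝ → ℂ} (hg : ContinuousOn g lowerTriangle)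
    (hf : ContinuousOn f (Icc 0 1)) : ContinuousOn (volterra g f) (Icc 0 1) := by
  have h1 : ∀ s, volterra g f s = s • ∫ u in (0 : ℝ)..1, g (s, s * u) * f (s * u) := fun s => by
    rw [intervalIntegral.smul_integral_comp_mul_left (fun t => g (s, t) * f t), mul_zero, mul_one]
    rfl
  have hgf := continuousOn_mul_comp_snd hg hf
  have hmem : ∀ s ∈ Icc (0 : ℝ) 1, ∀ u ∈ Icc (0 : ℝ) 1, (s, s * u) ∈ lowerTriangle :=
    fun s hs u hu => ⟨mul_nonneg hs.1 hu.1, mul_le_of_le_one_right hs.1 hu.2, hs.2⟩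
  obtain ⟨M, hM⟩ := isCompact_lowerTriangle.exists_bound_of_continuousOn hgf
  have h2 : ContinuousOn (fun s => ∫ u in Icc (0 : ℝ) 1, g (s, s * u) * f (s * u)) (Icc 0 1) := by
    refine continuousOn_of_dominated (bound := fun _ => M) (fun s hs => ?_) (fun s hs => ?_)
      (integrable_const M) ?_
    · refine ContinuousOn.aestronglyMeasurable ?_ measurableSet_Icc
      exact hgf.comp (f := fun u => (s, s * u)) (by fun_prop) (hmem s hs)
    · filter_upwards [ae_restrict_mem measurableSet_Icc] with u hu using hM _ (hmem s hs u hu)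
    · filter_upwards [ae_restrict_mem measurableSet_Icc] with u hu
      exact hgf.comp (f := fun s => (s, s * u)) (by fun_prop) fun s hs => hmem s hs u hu
  refine (continuousOn_id.smul h2).congr fun s _ => ?_
  rw [h1, intervalIntegral.integral_of_le zero_le_one, ← integral_Icc_eq_integral_Ioc]
  rfl

/-- Fubini on the triangle 0 ≤ t ≤ σ ≤ s, carried out for the extension by zero of the integrand. -/
lemma integral_volterra {g : ℝ × ℝ → ℂ} {f : ℝ → ℂ} (hg : ContinuousOn g lowerTriangle)
    (hf : ContinuousOn f (Icc 0 1)) {s : ℝ} (hs : s ∈ Icc (0 : ℝ) 1) :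
    ∫ σ in (0 : ℝ)..s, volterra g f σ = ∫ t in (0 : ℝ)..s, (∫ σ in t..s, g (σ, t)) * f t := by
  have hgf := continuousOn_mul_comp_snd hg hf
  let H : ℝ × ℝ → ℂ := lowerTriangle.indicator fun p => g p * f p.2
  have hmeas : MeasurableSet lowerTriangle := isCompact_lowerTriangle.isClosed.measurableSet
  have hH : Integrable H (volume.prod volume) :=
    (integrable_indicator_iff hmeas).2 (hgf.integrableOn_compact isCompact_lowerTriangle)
  have hH' : Integrable (Function.uncurry fun σ t => H (σ, t))
      ((volume.restrict (Ioc 0 s)).prod (volume.restrict (Ioc 0 s))) := by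
    rw [Measure.prod_restrict]
    exact hH.restrict
  have hswap := integral_integral_swap hH'
  have h1 : ∀ σ ∈ Ioc (0 : ℝ) s, ∫ t in Ioc (0 : ℝ) s, H (σ, t) = volterra g f σ := by
    intro σ hσ
    have : ∀ t ∈ Ioc (0 : ℝ) s, H (σ, t) = (Ioc 0 σ).indicator (fun t => g (σ, t) * f t) t := by
      intro t ht
      by_cases h : t ≤ σ
      · have hm : (σ, t) ∈ lowerTriangle := ⟨ht.1.le, h, hσ.2.trans hs.2⟩
        have hm' : t ∈ Ioc 0 σ := ⟨ht.1, h⟩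
        simp only [H]
        rw [indicator_of_mem hm, indicator_of_mem hm']
      · simp only [H]
        rw [indicator_of_notMem fun hm => h hm.2.1, indicator_of_notMem fun hm => h hm.2]
    rw [setIntegral_congr_fun measurableSet_Ioc this, setIntegral_indicator measurableSet_Ioc,
      inter_eq_self_of_subset_right (Ioc_subset_Ioc_right hσ.2), volterra,
      intervalIntegral.integral_of_le hσ.1.le]
  have h2 : ∀ t ∈ Ioc (0 : ℝ) s, ∫ σ in Ioc (0 : ℝ) s, H (σ, t)
      = (∫ σ in t..s, g (σ, t)) * f t := by
    intro t ht
    have : ∀ σ ∈ Ioc (0 : ℝ) s, H (σ, t) = (Icc t s).indicator (fun σ => g (σ, t) * f t) σ := by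
      intro σ hσ
      by_cases h : t ≤ σ
      · have hm : (σ, t) ∈ lowerTriangle := ⟨ht.1.le, h, hσ.2.trans hs.2⟩
        have hm' : σ ∈ Icc t s := ⟨h, hσ.2⟩
        simp only [H]
        rw [indicator_of_mem hm, indicator_of_mem hm']
      · simp only [H]
        rw [indicator_of_notMem fun hm => h hm.2.1, indicator_of_notMem fun hm => h hm.1]
    have hsub : Icc t s ⊆ Ioc 0 s := fun σ hσ => ⟨ht.1.trans_le hσ.1, hσ.2⟩
    rw [setIntegral_congr_fun measurableSet_Ioc this, setIntegral_indicator measurableSet_Icc,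
      inter_eq_self_of_subset_right hsub,
      integral_Icc_eq_integral_Ioc, ← intervalIntegral.integral_of_le ht.2,
      intervalIntegral.integral_mul_const]
  rw [intervalIntegral.integral_of_le hs.1, intervalIntegral.integral_of_le hs.1,
    ← setIntegral_congr_fun measurableSet_Ioc h1, ← setIntegral_congr_fun measurableSet_Ioc h2]
  exact hswap

/-- Leibniz' rule for Volterra integrals with merely continuous density. -/
lemma hasDerivWithinAt_volterra {g : ℝ × ℝ → ℂ} {f : ℝ → ℂ} (hg : ContDiffOn ℝ 1 g lowerTriangle)
    (hf : ContinuousOn f (Icc 0 1)) {s : ℝ} (hs : s ∈ Icc (0 : ℝ) 1) :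
    HasDerivWithinAt (volterra g f)
      (g (s, s) * f s + volterra (dirDeriv lowerTriangle g (1, 0)) f s) (Icc 0 1) s := by
  have hgd : DifferentiableOn ℝ g lowerTriangle := hg.differentiableOn one_ne_zero
  have hg' : ContinuousOn (dirDeriv lowerTriangle g (1, 0)) lowerTriangle :=
    (contDiffOn_dirDeriv (k := 0) uniqueDiffOn_lowerTriangle (by exact_mod_cast hg) _).continuousOn
  have hdiag : ContinuousOn (fun t => g (t, t) * f t) (Icc 0 1) :=
    (hg.continuousOn.comp (f := fun t : ℝ => (t, t)) (by fun_prop)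
      fun t ht => ⟨ht.1, le_rfl, ht.2⟩).mul hf
  have hcont := hdiag.add (continuousOn_volterra hg' hf)
  have hsub : ∀ s ∈ Icc (0 : ℝ) 1, uIcc 0 s ⊆ Icc (0 : ℝ) 1 := fun s hs => by
    rw [uIcc_of_le hs.1]; exact Icc_subset_Icc_right hs.2
  -- As g is controlled only on the triangle, nothing is differentiated under the integral sign.
  -- Instead the candidate derivative is integrated, and Fubini with the fundamental theorem in the
  -- first variable recovers the Volterra integral.
  have hV : ∀ s ∈ Icc (0 : ℝ) 1, volterra g f s = ∫ σ in (0 : ℝ)..s,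
      (g (σ, σ) * f σ + volterra (dirDeriv lowerTriangle g (1, 0)) f σ) := by
    intro s hs
    rw [intervalIntegral.integral_add (hdiag.mono (hsub s hs)).intervalIntegrable
      ((continuousOn_volterra hg' hf).mono (hsub s hs)).intervalIntegrable,
      integral_volterra hg' hf hs]
    have hftc : ∀ t ∈ uIcc 0 s, (∫ σ in t..s, dirDeriv lowerTriangle g (1, 0) (σ, t)) * f t
        = g (s, t) * f t - g (t, t) * f t := by
      intro t ht
      rw [uIcc_of_le hs.1] at ht
      have hmem : ∀ u ∈ Icc t s, (u, t) ∈ lowerTriangle := fun u hu =>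
        ⟨ht.1, hu.1, hu.2.trans hs.2⟩
      rw [intervalIntegral.integral_eq_sub_of_hasDerivAt_of_le ht.2
        (f := fun σ => g (σ, t)), sub_mul]
      · exact hg.continuousOn.comp (by fun_prop) hmem
      · intro u hu
        exact (hasDerivWithinAt_slice_fst hgd (hmem u (Ioo_subset_Icc_self hu)) hmem).hasDerivAt
          (Icc_mem_nhds hu.1 hu.2)
      · refine ContinuousOn.intervalIntegrable ?_
        rw [uIcc_of_le ht.2]
        exact hg'.comp (by fun_prop) hmem
    rw [intervalIntegral.integral_congr hftc, intervalIntegral.integral_sub,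
      add_sub_cancel, volterra]
    · refine ContinuousOn.intervalIntegrable ?_
      rw [uIcc_of_le hs.1]
      exact (continuousOn_mul_comp_snd hg.continuousOn hf).comp (f := fun t => (s, t))
        (by fun_prop) fun t ht => ⟨ht.1, ht.2, hs.2⟩
    · exact (hdiag.mono (hsub s hs)).intervalIntegrable
  -- This instance makes the fundamental theorem available within `Icc 0 1`, endpoints included.
  have hF : Fact (s ∈ Icc (0 : ℝ) 1) := ⟨hs⟩
  have h1 := intervalIntegral.integral_hasDerivWithinAt_right (a := 0) (b := s)
    (s := Icc 0 1) (t := Icc 0 1) (hcont.mono (hsub s hs)).intervalIntegrable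
    (hcont.stronglyMeasurableAtFilter_nhdsWithin measurableSet_Icc s) (hcont s hs)
  exact h1.congr hV (hV s hs)

/-- The derivative is g(s,s)f(s), as smooth as f for the order needed, plus a Volterra integral with
kernel ∂ₛg, to which the induction applies. Truncated subtraction makes k = 0 ask only for
continuity of f. -/
lemma contDiffOn_volterra : ∀ (k : ℕ) {g : ℝ × ℝ → ℂ} {f : ℝ → ℂ},
    ContDiffOn ℝ (k : WithTop ℕ∞) g lowerTriangle →
    ContDiffOn ℝ ((k - 1 : ℕ) : WithTop ℕ∞) f (Icc 0 1) →
    ContDiffOn ℝ (k : WithTop ℕ∞) (volterra g f) (Icc 0 1)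
  | 0, g, f, hg, hf => by
    rw [Nat.cast_zero, contDiffOn_zero]
    exact continuousOn_volterra hg.continuousOn hf.continuousOn
  | k + 1, g, f, hg, hf => by
    have hg1 : ContDiffOn ℝ 1 g lowerTriangle :=
      hg.of_le (by exact_mod_cast Nat.le_add_left 1 k)
    have hder := fun s (hs : s ∈ Icc (0 : ℝ) 1) => hasDerivWithinAt_volterra hg1 hf.continuousOn hs
    have hu := uniqueDiffOn_Icc (zero_lt_one (α := ℝ))
    push_cast
    rw [contDiffOn_succ_iff_derivWithin hu]
    refine ⟨fun s hs => (hder s hs).differentiableWithinAt, fun h => by simp at h, ?_⟩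
    have hfk : ContDiffOn ℝ (k : WithTop ℕ∞) f (Icc 0 1) := hf
    have hdiag : ContDiffOn ℝ (k : WithTop ℕ∞) (fun t : ℝ => g (t, t)) (Icc 0 1) :=
      (hg.of_le (by exact_mod_cast Nat.le_succ k)).comp (f := fun t : ℝ => (t, t))
        (by fun_prop) fun t ht => ⟨ht.1, le_rfl, ht.2⟩
    refine ((hdiag.mul hfk).add (contDiffOn_volterra k
      (contDiffOn_dirDeriv uniqueDiffOn_lowerTriangle hg (1, 0))
      (hfk.of_le (by exact_mod_cast Nat.sub_le k 1)))).congr fun s hs => ?_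
    exact (hder s hs).derivWithin (hu s hs)

/-- The reflection (s,t) ↦ (1 − s, 1 − t) exchanges the two triangles. -/
lemma contDiffOn_volterra_upper (k : ℕ) {g : ℝ × ℝ → ℂ} {f : ℝ → ℂ}
    (hg : ContDiffOn ℝ (k : WithTop ℕ∞) g upperTriangle)
    (hf : ContDiffOn ℝ ((k - 1 : ℕ) : WithTop ℕ∞) f (Icc 0 1)) :
    ContDiffOn ℝ (k : WithTop ℕ∞) (fun s => ∫ t in s..1, g (s, t) * f t) (Icc 0 1) := by
  have hrefl : MapsTo (fun t : ℝ => 1 - t) (Icc 0 1) (Icc 0 1) := fun t ht =>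
    ⟨by linarith [ht.2], by linarith [ht.1]⟩
  have h := contDiffOn_volterra k (g := fun p => g (1 - p.1, 1 - p.2)) (f := fun t => f (1 - t))
    (hg.comp (f := fun p : ℝ × ℝ => (1 - p.1, 1 - p.2)) (by fun_prop) fun p hp =>
      ⟨by linarith [hp.2.2], by linarith [hp.2.1], by linarith [hp.1]⟩)
    (hf.comp (by fun_prop) hrefl)
  refine (h.comp (f := fun t : ℝ => 1 - t) (by fun_prop) hrefl).congr fun s _ => ?_
  simp only [Function.comp, volterra, sub_sub_cancel]
  rw [intervalIntegral.integral_comp_sub_left (fun t => g (s, t) * f t)]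
  simp

/-! ### Local polynomial approximation -/

open Polynomial in
lemma exists_antiderivative (p : ℂ[X]) : ∃ q : ℂ[X], derivative q = p ∧
    q.natDegree ≤ p.natDegree + 1 := by
  refine ⟨∑ k ∈ Finset.range (p.natDegree + 1), monomial (k + 1) (p.coeff k / (k + 1 : ℂ)), ?_, ?_⟩
  · rw [derivative_sum]
    conv_rhs => rw [p.as_sum_range]
    refine Finset.sum_congr rfl fun k _ => ?_
    rw [derivative_monomial, Nat.add_sub_cancel]
    push_cast
    rw [div_mul_cancel₀ _ (by exact_mod_cast Nat.succ_ne_zero k)]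
  · refine natDegree_sum_le_of_forall_le _ _ fun k hk => (natDegree_monomial_le _).trans ?_
    have := Finset.mem_range.1 hk
    omega

open Polynomial in
/-- A `C^{d+1}` function is approximated to order `d + 1` by polynomials of degree `d`. -/
lemma exists_polynomial_approx : ∀ (d : ℕ) {f : ℝ → ℂ},
    ContDiffOn ℝ ((d + 1 : ℕ) : WithTop ℕ∞) f (Icc 0 1) → ∃ M : ℝ, 0 ≤ M ∧
    ∀ a b : ℝ, 0 ≤ a → a ≤ b → b ≤ 1 → ∃ p : ℂ[X], p.natDegree ≤ d ∧
      ∀ t ∈ Icc a b, ‖f t - p.eval (t : ℂ)‖ ≤ M * (b - a) ^ (d + 1) := by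
  -- Matching f and p at a and integrating the error of the derivatives costs one factor b − a and
  -- leaves M unchanged. The induction applies this to an antiderivative of an approximant of f'.
  have step : ∀ (d : ℕ) {f : ℝ → ℂ}, ContDiffOn ℝ 1 f (Icc 0 1) → ∀ M a b : ℝ, 0 ≤ M → 0 ≤ a →
      a ≤ b → b ≤ 1 → ∀ p : ℂ[X], (∀ t ∈ Icc a b, ‖derivWithin f (Icc 0 1) t
        - (derivative p).eval (t : ℂ)‖ ≤ M * (b - a) ^ d) →
      ∀ t ∈ Icc a b, ‖f t - (p + C (f a - p.eval (a : ℂ))).eval (t : ℂ)‖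
        ≤ M * (b - a) ^ (d + 1) := by
    intro d f hf M a b hM ha hab hb p hp t ht
    have hd : ∀ u ∈ Icc a b, HasDerivWithinAt (fun u : ℝ => f u - p.eval (u : ℂ))
        (derivWithin f (Icc 0 1) u - (derivative p).eval (u : ℂ)) (Icc a b) u := fun u hu => by
      have h1 : HasDerivWithinAt f (derivWithin f (Icc 0 1) u) (Icc a b) u :=
        ((hf.differentiableOn one_ne_zero) u ⟨ha.trans hu.1, hu.2.trans hb⟩).hasDerivWithinAt.mono
          (Icc_subset_Icc ha hb)
      exact h1.sub ((p.hasDerivAt (u : ℂ)).comp_ofReal.hasDerivWithinAt)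
    have h2 := (convex_Icc a b).norm_image_sub_le_of_norm_hasDerivWithin_le hd hp
      (left_mem_Icc.2 hab) ht
    rw [eval_add, eval_C, show f t - (p.eval (t : ℂ) + (f a - p.eval (a : ℂ)))
      = f t - p.eval (t : ℂ) - (f a - p.eval (a : ℂ)) by ring]
    refine h2.trans ?_
    rw [pow_succ, ← mul_assoc]
    have hba : 0 ≤ b - a := sub_nonneg.2 hab
    gcongr
    rw [Real.norm_eq_abs, abs_of_nonneg (sub_nonneg.2 ht.1)]
    linarith [ht.2]
  have hu := uniqueDiffOn_Icc (zero_lt_one (α := ℝ))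
  intro d
  induction d with
  | zero =>
    intro f hf
    have hf1 : ContDiffOn ℝ 1 f (Icc 0 1) := by simpa using hf
    obtain ⟨M, hM⟩ := isCompact_Icc.exists_bound_of_continuousOn
      (hf1.continuousOn_derivWithin hu le_rfl)
    refine ⟨max M 0, le_max_right _ _, fun a b ha hab hb => ⟨_, ?_,
      step 0 hf1 (max M 0) a b (le_max_right _ _) ha hab hb 0 fun t ht => ?_⟩⟩
    · simp
    · simpa using Or.inl (hM t ⟨ha.trans ht.1, ht.2.trans hb⟩)
  | succ d ih =>
    intro f hf
    obtain ⟨M, hM0, hM⟩ := ih (f := derivWithin f (Icc 0 1))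
      (hf.derivWithin hu (by push_cast; rfl))
    refine ⟨M, hM0, fun a b ha hab hb => ?_⟩
    obtain ⟨q, hq, hqM⟩ := hM a b ha hab hb
    obtain ⟨p, rfl, hp⟩ := exists_antiderivative q
    refine ⟨_, ?_, step (d + 1) (hf.of_le (by exact_mod_cast Nat.le_add_left 1 (d + 1))) M a b hM0
      ha hab hb p hqM⟩
    refine natDegree_add_le_of_degree_le (hp.trans (by omega)) ?_
    simp

/-! ### Smoothness of eigenfunctions -/

namespace GreenKernel

variable {α : ℕ} (κ : GreenKernel α)

lemma coeFn_integralOperator (x : LInf) :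
    κ.integralOperator x =ᵐ[unitMeasure] κ.integralFun x :=
  MemLp.coeFn_toLp (κ.memLp_integralFun x)

lemma integralFun_congr {f : ℝ → ℂ} {x : LInf} (h : x =ᵐ[unitMeasure] f) (s : ℝ) :
    κ.integralFun x s = ∫ t, (κ.kernel s t : ℂ) * f t ∂unitMeasure := by
  refine integral_congr_ae ?_
  filter_upwards [h] with t ht
  rw [ht]

lemma continuousOn_kernel_snd {s : ℝ} (hs : s ∈ Icc (0 : ℝ) 1) :
    ContinuousOn (fun t => (κ.kernel s t : ℂ)) (Icc 0 1) :=
  Complex.continuous_ofReal.comp_continuousOn (κ.continuousOn_kernel.comp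
    (f := fun t : ℝ => (s, t)) (by fun_prop) fun _ ht => ⟨hs, ht⟩)

/-- Integral operators with a Green's kernel gain a derivative. -/
lemma contDiffOn_integral {f : ℝ → ℂ} {k : ℕ} (hk : k + 1 ≤ α)
    (hf : ContDiffOn ℝ (k : WithTop ℕ∞) f (Icc 0 1)) :
    ContDiffOn ℝ ((k + 1 : ℕ) : WithTop ℕ∞)
      (fun s => ∫ t, (κ.kernel s t : ℂ) * f t ∂unitMeasure) (Icc 0 1) := by
  have hle : ((k + 1 : ℕ) : WithTop ℕ∞) ≤ (α : WithTop ℕ∞) := by exact_mod_cast hk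
  have h1 := contDiffOn_volterra (k + 1) (κ.contDiffOn_kernel_lowerTriangle.of_le hle) hf
  have h2 := contDiffOn_volterra_upper (k + 1) (κ.contDiffOn_kernel_upperTriangle.of_le hle) hf
  refine (h1.add h2).congr fun s hs => ?_
  have hc : ContinuousOn (fun t => (κ.kernel s t : ℂ) * f t) (Icc 0 1) :=
    (κ.continuousOn_kernel_snd hs).mul hf.continuousOn
  rw [integral_unitMeasure]
  refine (intervalIntegral.integral_add_adjacent_intervals ?_ ?_).symm
  · refine (hc.mono ?_).intervalIntegrable
    rw [uIcc_of_le hs.1]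
    exact Icc_subset_Icc_right hs.2
  · refine (hc.mono ?_).intervalIntegrable
    rw [uIcc_of_le hs.2]
    exact Icc_subset_Icc_left hs.1

lemma norm_integralFun_sub_le {M : ℝ} (hM : ∀ t ∈ Icc (0 : ℝ) 1, ∀ s ∈ Icc (0 : ℝ) 1,
      ∀ s' ∈ Icc (0 : ℝ) 1, ‖(κ.kernel s t : ℂ) - κ.kernel s' t‖ ≤ M * |s - s'|) (x : LInf)
    {s s' : ℝ} (hs : s ∈ Icc (0 : ℝ) 1) (hs' : s' ∈ Icc (0 : ℝ) 1) :
    ‖κ.integralFun x s - κ.integralFun x s'‖ ≤ M * |s - s'| * ‖x‖ := by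
  rw [integralFun, integralFun, ← integral_sub (κ.integrable_integrand x hs)
    (κ.integrable_integrand x hs')]
  have := norm_integral_le_of_norm_le_const (μ := unitMeasure) (C := M * |s - s'| * ‖x‖)
    (f := fun t => (κ.kernel s t : ℂ) * x t - κ.kernel s' t * x t) (by
      filter_upwards [ae_norm_le x, ae_restrict_mem measurableSet_Icc] with t h1 h2
      rw [← sub_mul, norm_mul]
      have := hM t h2 s hs s' hs'
      gcongr
      exact (norm_nonneg _).trans this)
  simpa using this

/-- Eigenfunctions have a representative that is as smooth as the branches of the kernel. -/
lemma exists_contDiffOn_representative (hα : 2 ≤ α) {lam : ℂ} (hlam : lam ≠ 0) {φ : LInf}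
    (hφ : κ.integralOperator φ = lam • φ) : ∃ f : ℝ → ℂ, φ =ᵐ[unitMeasure] f ∧
      ∀ k ≤ α, ContDiffOn ℝ (k : WithTop ℕ∞) f (Icc 0 1) := by
  obtain ⟨M, hM0, hM, -⟩ := κ.exists_kernel_bounds hα
  let f : ℝ → ℂ := fun s => lam⁻¹ * κ.integralFun φ s
  have hφf : φ =ᵐ[unitMeasure] f := by
    have h1 : φ = lam⁻¹ • κ.integralOperator φ := by rw [hφ, inv_smul_smul₀ hlam]
    filter_upwards [Lp.coeFn_smul lam⁻¹ (κ.integralOperator φ), κ.coeFn_integralOperator φ]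
      with t h2 h3
    rw [h1, h2, Pi.smul_apply, h3, smul_eq_mul]
  -- The bootstrap equation: f is Lipschitz to begin with, and each passage through the integral
  -- gains a derivative until α is reached.
  have hf : ∀ s, f s = lam⁻¹ * ∫ t, (κ.kernel s t : ℂ) * f t ∂unitMeasure := fun s => by
    rw [← κ.integralFun_congr hφf]
  have hf0 : ContinuousOn f (Icc 0 1) := by
    refine ContinuousOn.mul continuousOn_const ?_
    refine LipschitzOnWith.continuousOn (K := (M * ‖φ‖).toNNReal) ?_
    refine LipschitzOnWith.of_dist_le_mul fun s hs s' hs' => ?_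
    rw [Real.coe_toNNReal _ (by positivity), dist_eq_norm, Real.dist_eq]
    refine (κ.norm_integralFun_sub_le hM φ hs hs').trans (le_of_eq (by ring))
  refine ⟨f, hφf, fun k => ?_⟩
  induction k with
  | zero => exact fun _ => by rw [Nat.cast_zero, contDiffOn_zero]; exact hf0
  | succ k ih =>
    intro hk
    exact (contDiffOn_const.mul (κ.contDiffOn_integral hk (ih (by omega)))).congr fun s _ => hf s

end GreenKernel

/-! ### Error estimates for the modified Galerkin operator -/

lemma mem_cell_right {n : ℕ} (hn : 0 < n) (j : ℕ) : ((j + 1 : ℝ) / n) ∈ cell n j := by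
  have hn' : (0 : ℝ) < n := by exact_mod_cast hn
  refine ⟨?_, le_rfl⟩
  gcongr
  linarith

lemma abs_sub_le_of_mem_cell {n j : ℕ} {s t : ℝ} (hs : s ∈ cell n j) (ht : t ∈ cell n j) :
    |s - t| ≤ 1 / n := by
  have h : (j + 1 : ℝ) / n = j / n + 1 / n := add_div _ _ _
  have h1 := hs.1
  have h2 := hs.2
  have h3 := ht.1
  have h4 := ht.2
  rw [abs_le]
  constructor <;> linarith

lemma le_or_le_of_mem_cell {n i j : ℕ} (hn : 0 < n) (hij : j ≠ i) :
    (∀ s ∈ cell n i, s ≤ (j : ℝ) / n) ∨ ∀ s ∈ cell n i, (j + 1 : ℝ) / n ≤ s := by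
  have hn' : (0 : ℝ) < n := by exact_mod_cast hn
  rcases lt_or_gt_of_ne hij with h | h
  · right
    intro s hs
    refine le_trans ?_ hs.1.le
    gcongr
    exact_mod_cast h
  · left
    intro s hs
    refine hs.2.trans ?_
    gcongr
    exact_mod_cast h

open Polynomial in
-- The projection error is orthogonal on each cell to polynomials of degree at most 2r, so p may be
-- subtracted from g at no cost.
lemma norm_setIntegral_cell_mul_le {r n j : ℕ} (hj : j < n) {g : ℝ → ℂ}
    (hg : ContinuousOn g (Icc 0 1)) (x : LInf) {p : ℂ[X]} (hp : p.natDegree ≤ 2 * r) {ε : ℝ}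
    (h : ∀ t ∈ cell n j, ‖g t - p.eval (t : ℂ)‖ ≤ ε) :
    ‖∫ t in cell n j, g t * (x - galerkinProjection r n x) t‖
      ≤ ε * ‖x - galerkinProjection r n x‖ * (1 / n) := by
  have hn : 0 < n := (Nat.zero_le j).trans_lt hj
  have hpc : Continuous fun t : ℝ => p.eval (t : ℂ) := by fun_prop
  have h1 : ∫ t in cell n j, g t * (x - galerkinProjection r n x) t
      = ∫ t in cell n j, (g t * (x - galerkinProjection r n x) t
        - p.eval (t : ℂ) * (x - galerkinProjection r n x) t) := by
    rw [integral_sub (integrableOn_cell hj (integrable_mul_LInf hg _))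
      (integrableOn_cell hj (integrable_mul_LInf hpc.continuousOn _)),
      setIntegral_eval_mul_sub_galerkinProjection hj hp, sub_zero]
  rw [h1]
  refine norm_setIntegral_cell_le hn ?_
  filter_upwards [ae_restrict_cell hj (ae_norm_le (x - galerkinProjection r n x)),
    ae_restrict_mem (measurableSet_cell n j)] with t k1 k2
  rw [← sub_mul, norm_mul]
  have := h t k2
  gcongr
  exact (norm_nonneg _).trans this

/-- The cells away from the diagonal are at most n in number and add up to a; the exceptional cell i
contributes once and keeps its factor 1/n. -/
lemma norm_integral_le_of_cells {n i : ℕ} (hn : 0 < n) {f : ℝ → ℂ} (hf : Integrable f unitMeasure)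
    {a b : ℝ} (hb : 0 ≤ b) (h1 : ∀ j < n, j ≠ i → ‖∫ t in cell n j, f t‖ ≤ a * (1 / n))
    (h2 : i < n → ‖∫ t in cell n i, f t‖ ≤ b * (1 / n)) (ha : 0 ≤ a) :
    ‖∫ t, f t ∂unitMeasure‖ ≤ a + b * (1 / n) := by
  have hn' : (0 : ℝ) < n := by exact_mod_cast hn
  rw [integral_eq_sum_cells hn hf]
  have h3 : ∀ j ∈ Finset.range n, ‖∫ t in cell n j, f t‖
      ≤ a * (1 / n) + if j = i then b * (1 / n) else 0 := by
    intro j hj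
    have hj' := Finset.mem_range.1 hj
    split_ifs with hji
    · subst hji
      have := h2 hj'
      have : 0 ≤ a * (1 / n) := by positivity
      linarith
    · rw [add_zero]
      exact h1 j hj' hji
  refine (norm_sum_le_of_le _ h3).trans ?_
  rw [Finset.sum_add_distrib, Finset.sum_const, Finset.card_range, Finset.sum_ite_eq', nsmul_eq_mul]
  have h4 : (n : ℝ) * (a * (1 / n)) = a := by field_simp
  rw [h4]
  gcongr
  split_ifs
  · exact le_rfl
  · positivity

/-! ### The integral operator on projection errors -/

namespace GreenKernel

variable {α : ℕ} (κ : GreenKernel α)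

open Polynomial in
/-- Pointwise bound of `𝒦 (I - Pₙ) x`. -/
lemma exists_norm_integralFun_sub_projection_le (hα : 2 ≤ α) (r : ℕ) : ∃ M : ℝ, 0 ≤ M ∧
    ∀ n : ℕ, 0 < n → ∀ x : LInf, ∀ s ∈ Ioc (0 : ℝ) 1,
      ‖κ.integralFun (x - galerkinProjection r n x) s‖
        ≤ M * (1 / n) ^ (if r = 0 then 1 else 2) * ‖x - galerkinProjection r n x‖ := by
  obtain ⟨M, hM, -, hlip, htay, -⟩ := κ.exists_kernel_bounds hα
  refine ⟨2 * M, by positivity, fun n hn x s hs => ?_⟩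
  obtain ⟨i, hi, hsi⟩ := exists_mem_cell hn hs
  have hs' := Ioc_subset_Icc_self hs
  have hn' : (1 : ℝ) ≤ n := by exact_mod_cast hn
  have hh1 : 1 / (n : ℝ) ≤ 1 := by rw [div_le_one (by linarith)]; exact hn'
  set h : ℝ := 1 / n
  have hh0 : 0 < h := by positivity
  set ψ := x - galerkinProjection r n x
  have hg := κ.continuousOn_kernel_snd hs'
  -- Subtracting a constant needs only Lipschitz continuity, so it works even on the cell containing
  -- s; for r = 0 it is used on every cell.
  have hconst : ∀ j < n, ∀ t₀ ∈ cell n j,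
      ‖∫ t in cell n j, (κ.kernel s t : ℂ) * ψ t‖ ≤ M * h * ‖ψ‖ * h := by
    intro j hj t₀ ht₀
    refine norm_setIntegral_cell_mul_le hj hg x (p := C (κ.kernel s t₀ : ℂ)) (by simp) fun t ht => ?_
    rw [eval_C]
    refine (hlip s hs' t (cell_subset hj ht) t₀ (cell_subset hj ht₀)).trans ?_
    gcongr
    exact abs_sub_le_of_mem_cell ht ht₀
  have hoff : ∀ j < n, j ≠ i → ‖∫ t in cell n j, (κ.kernel s t : ℂ) * ψ t‖
      ≤ M * h ^ (if r = 0 then 1 else 2) * ‖ψ‖ * h := by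
    intro j hj hji
    split_ifs with hr
    · rw [pow_one]
      exact hconst j hj _ (mem_cell_right hn j)
    -- For r ≥ 1 affine functions are admissible, since 1 ≤ 2r.
    · have hb1 : (j + 1 : ℝ) / n ≤ 1 := (cell_subset hj (mem_cell_right hn j)).2
      have hba : (j + 1 : ℝ) / n - j / n = h := by rw [add_div]; ring
      obtain ⟨A, B, hAB⟩ := htay (j / n) ((j + 1) / n) s (by positivity)
        (by linarith) hb1 hs' ((le_or_le_of_mem_cell hn hji).imp (fun k => k s hsi)
          fun k => k s hsi)
      rw [hba] at hAB
      refine norm_setIntegral_cell_mul_le hj hg x (p := C A + C B * X) ?_ fun t ht => ?_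
      · have : (C A + C B * X : ℂ[X]).natDegree ≤ 1 := by compute_degree
        omega
      · simpa using hAB t (Ioc_subset_Icc_self ht)
  have key := norm_integral_le_of_cells hn (κ.integrable_integrand ψ hs') (i := i)
    (a := M * h ^ (if r = 0 then 1 else 2) * ‖ψ‖) (b := M * h * ‖ψ‖) (by positivity)
    hoff (fun _ => hconst i hi s hsi) (by positivity)
  refine key.trans ?_
  -- On the cell containing s one h comes from the Lipschitz bound and one from its length, which
  -- suffices in both cases.
  have hpow : h * h ≤ h ^ (if r = 0 then 1 else 2) := by
    rw [← sq]
    exact pow_le_pow_of_le_one hh0.le hh1 (by split_ifs <;> norm_num)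
  calc M * h ^ (if r = 0 then 1 else 2) * ‖ψ‖ + M * h * ‖ψ‖ * h
      = M * h ^ (if r = 0 then 1 else 2) * ‖ψ‖ + M * (h * h) * ‖ψ‖ := by ring
    _ ≤ M * h ^ (if r = 0 then 1 else 2) * ‖ψ‖ + M * h ^ (if r = 0 then 1 else 2) * ‖ψ‖ := by
      gcongr
    _ = _ := by ring

open Polynomial in
/-- The oscillation of `𝒦 (I - Pₙ) x` on a cell. -/
lemma exists_norm_integralFun_oscillation_le (hα : 2 ≤ α) (r : ℕ) : ∃ M : ℝ, 0 ≤ M ∧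
    ∀ n : ℕ, 0 < n → ∀ x : LInf, ∀ i < n, ∀ s ∈ cell n i, ∀ s' ∈ cell n i,
      ‖κ.integralFun (x - galerkinProjection r n x) s
          - κ.integralFun (x - galerkinProjection r n x) s'‖
        ≤ M * (1 / n) ^ 2 * ‖x - galerkinProjection r n x‖ := by
  obtain ⟨M, hM, hlip, -, -, hmix⟩ := κ.exists_kernel_bounds hα
  refine ⟨2 * M, by positivity, fun n hn x i hi s hs s' hs' => ?_⟩
  have hs0 := cell_subset hi hs
  have hs0' := cell_subset hi hs'
  have hss := abs_sub_le_of_mem_cell hs hs'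
  set h : ℝ := 1 / n
  have hh0 : 0 ≤ h := by positivity
  set ψ := x - galerkinProjection r n x
  have hg := (κ.continuousOn_kernel_snd hs0).sub (κ.continuousOn_kernel_snd hs0')
  -- Subtracting the value at the right endpoint turns the difference of kernels into a mixed second
  -- difference, of order h in each variable. Constants are enough, so the gain h² holds for r = 0
  -- too.
  have hoff : ∀ j < n, j ≠ i →
      ‖∫ t in cell n j, ((κ.kernel s t : ℂ) - κ.kernel s' t) * ψ t‖ ≤ M * h ^ 2 * ‖ψ‖ * h := by
    intro j hj hji
    have ht₀ := mem_cell_right hn j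
    refine norm_setIntegral_cell_mul_le hj hg x (p := C ((κ.kernel s ((j + 1) / n) : ℂ)
      - κ.kernel s' ((j + 1) / n))) (by simp) fun t ht => ?_
    rw [eval_C]
    refine (hmix (j / n) ((j + 1) / n) s s' (by positivity) (cell_subset hj ht₀).2 hs0 hs0'
      ((le_or_le_of_mem_cell hn hji).imp (fun k => ⟨k s hs, k s' hs'⟩)
        fun k => ⟨k s hs, k s' hs'⟩) _ (Ioc_subset_Icc_self ht₀) t
        (Ioc_subset_Icc_self ht)).trans ?_
    calc _ ≤ M * h * h := by
          gcongr
          exact abs_sub_le_of_mem_cell ht ht₀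
      _ = _ := by ring
  have hon : ‖∫ t in cell n i, ((κ.kernel s t : ℂ) - κ.kernel s' t) * ψ t‖
      ≤ M * h * ‖ψ‖ * h := by
    refine norm_setIntegral_cell_mul_le hi hg x (p := 0) (by simp) fun t ht => ?_
    rw [eval_zero, sub_zero]
    exact (hlip t (cell_subset hi ht) s hs0 s' hs0').trans (by gcongr)
  have key := norm_integral_le_of_cells hn (integrable_mul_LInf hg ψ) (i := i)
    (a := M * h ^ 2 * ‖ψ‖) (b := M * h * ‖ψ‖) (by positivity) hoff (fun _ => hon) (by positivity)
  have heq : κ.integralFun ψ s - κ.integralFun ψ s'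
      = ∫ t, ((κ.kernel s t : ℂ) - κ.kernel s' t) * ψ t ∂unitMeasure := by
    rw [integralFun, integralFun, ← integral_sub (κ.integrable_integrand ψ hs0)
      (κ.integrable_integrand ψ hs0')]
    simp only [sub_mul]
  rw [heq]
  exact key.trans (le_of_eq (by ring))

lemma sub_modifiedOperator_apply (r n : ℕ) (x : LInf) :
    (κ.integralOperator - modifiedOperator κ r n) x
      = κ.integralOperator (x - galerkinProjection r n x)
        - galerkinProjection r n (κ.integralOperator (x - galerkinProjection r n x)) := by
  simp only [modifiedOperator, sub_apply, add_apply, ContinuousLinearMap.comp_apply, map_sub]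
  abel

open Polynomial in
/-- Norm estimates for `𝒦 - 𝒦ₙᴹ = (I - Pₙ) 𝒦 (I - Pₙ)` and `𝒦 (𝒦 - 𝒦ₙᴹ)`. -/
lemma exists_norm_sub_modifiedOperator_le (hα : 2 ≤ α) (r : ℕ) : ∃ Q : ℝ, 0 ≤ Q ∧
    ∀ n : ℕ, 0 < n → ∀ x : LInf,
      ‖(κ.integralOperator - modifiedOperator κ r n) x‖
        ≤ Q * (1 / n) ^ 2 * ‖x - galerkinProjection r n x‖ ∧
      ‖(κ.integralOperator - modifiedOperator κ r n) x‖ ≤ Q * (1 / n) ^ 2 * ‖x‖ ∧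
      ‖κ.integralOperator ((κ.integralOperator - modifiedOperator κ r n) x)‖
        ≤ Q * (1 / n) ^ (if r = 0 then 1 else 2)
          * ‖(κ.integralOperator - modifiedOperator κ r n) x‖ := by
  obtain ⟨M₁, hM₁, h1⟩ := κ.exists_norm_integralFun_sub_projection_le hα r
  obtain ⟨M₂, hM₂, h2⟩ := κ.exists_norm_integralFun_oscillation_le hα r
  obtain ⟨B, hB, hP⟩ := exists_norm_sub_galerkinProjection_le r
  have hB0 : 0 ≤ B := by linarith
  refine ⟨M₁ + B * M₂ * B, by positivity, fun n hn x => ?_⟩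
  obtain ⟨hPbd, hPdist⟩ := hP n hn
  have hn' : (0 : ℝ) < n := by exact_mod_cast hn
  have hD : ‖(κ.integralOperator - modifiedOperator κ r n) x‖
      ≤ B * M₂ * (1 / n) ^ 2 * ‖x - galerkinProjection r n x‖ := by
    rw [sub_modifiedOperator_apply]
    -- On each cell 𝒦(I − Pₙ)x is compared with the constant equal to its value at the right
    -- endpoint.
    refine (hPdist _ (M₂ * (1 / n) ^ 2 * ‖x - galerkinProjection r n x‖) (by positivity)
      fun j hj => ⟨C (κ.integralFun (x - galerkinProjection r n x) ((j + 1) / n)), by simp, ?_⟩).trans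
      (le_of_eq (by ring))
    filter_upwards [κ.coeFn_integralOperator (x - galerkinProjection r n x)] with t ht htj
    rw [ht, eval_C]
    exact h2 n hn x j hj t htj _ (mem_cell_right hn j)
  have hBM : B * M₂ ≤ B * M₂ * B := le_mul_of_one_le_right (by positivity) hB
  refine ⟨hD.trans ?_, hD.trans ?_, ?_⟩
  · gcongr
    linarith
  · calc B * M₂ * (1 / n) ^ 2 * ‖x - galerkinProjection r n x‖
        ≤ B * M₂ * (1 / n) ^ 2 * (B * ‖x‖) := by gcongr; exact hPbd x
      _ = B * M₂ * B * (1 / n) ^ 2 * ‖x‖ := by ring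
      _ ≤ _ := by gcongr; linarith
  · set y := (κ.integralOperator - modifiedOperator κ r n) x with hy
    -- As Pₙy = 0, y is its own projection error, and the bound for 𝒦(I − Pₙ) applies to 𝒦y.
    have hPy : galerkinProjection r n y = 0 := by
      rw [hy, sub_modifiedOperator_apply, map_sub,
        galerkinProjection_of_mem (galerkinProjection_mem r n _), sub_self]
    have h3 : ‖κ.integralOperator y‖ ≤ M₁ * (1 / n) ^ (if r = 0 then 1 else 2) * ‖y‖ := by
      refine norm_le_of_ae_cells hn (by positivity) ?_
      filter_upwards [κ.coeFn_integralOperator y] with t ht j hj htj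
      have := h1 n hn y t (cell_subset_Ioc hj htj)
      rw [hPy, sub_zero] at this
      rwa [ht]
    refine h3.trans ?_
    gcongr
    have : 0 ≤ B * M₂ * B := by positivity
    linarith

/-- The projection error of an eigenfunction. -/
lemma exists_norm_eigenfunction_sub_projection_le {r : ℕ} (hα : 2 * r + 2 ≤ α) {lam : ℂ}
    (hlam : lam ≠ 0) {φ : LInf} (hφ : κ.integralOperator φ = lam • φ) : ∃ C : ℝ, 0 ≤ C ∧
    ∀ n : ℕ, 0 < n → ‖φ - galerkinProjection r n φ‖ ≤ C * (1 / n) ^ (2 * r + 1) := by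
  obtain ⟨f, hφf, hf⟩ := κ.exists_contDiffOn_representative (by omega) hlam hφ
  obtain ⟨M, hM, hfM⟩ := exists_polynomial_approx (2 * r) (hf (2 * r + 1) (by omega))
  obtain ⟨B, hB, hP⟩ := exists_norm_sub_galerkinProjection_le r
  refine ⟨B * M, by positivity, fun n hn => ?_⟩
  have hn' : (0 : ℝ) < n := by exact_mod_cast hn
  rw [mul_assoc]
  refine (hP n hn).2 φ _ (by positivity) fun j hj => ?_
  have hba : (j + 1 : ℝ) / n - j / n = 1 / n := by rw [add_div]; ring
  have hpos : (0 : ℝ) < 1 / n := by positivity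
  obtain ⟨p, hp, hpM⟩ := hfM (j / n) ((j + 1) / n) (by positivity) (by linarith)
    (cell_subset hj (mem_cell_right hn j)).2
  rw [hba] at hpM
  refine ⟨p, hp, ?_⟩
  filter_upwards [hφf] with t ht htj
  rw [ht]
  exact hpM t (Ioc_subset_Icc_self htj)

end GreenKernel

lemma spectralProjection_eq_rieszProj (T : LInf →L[ℂ] LInf) (c : ℂ) (ρ : ℝ) :
    spectralProjection T c ρ = rieszProj T c ρ := rfl

end GreenGalerkin

end

/-! ### Assembly of the rates -/

theorem mainTheorem2 (r α : ℕ) (hα : 2 * r + 2 ≤ α) (κ : GreenGalerkin.GreenKernel α)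
    (lam : ℂ) (hlam : lam ≠ 0)
    (heig : Module.End.HasEigenvalue
      (κ.integralOperator : GreenGalerkin.LInf →ₗ[ℂ] GreenGalerkin.LInf) lam)
    (ρ : ℝ) (hρ : GreenGalerkin.Isolates κ.integralOperator lam ρ)
    (hsimple : Module.finrank ℂ (LinearMap.range
      (GreenGalerkin.spectralProjection κ.integralOperator lam ρ :
        GreenGalerkin.LInf →ₗ[ℂ] GreenGalerkin.LInf)) = 1) :
    ∃ (C : ℝ) (N : ℕ), 1 ≤ N ∧ ∀ n : ℕ, N ≤ n →
      Metric.sphere lam ρ ⊆ resolventSet ℂ (GreenGalerkin.modifiedOperator κ r n) ∧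
      Module.finrank ℂ (LinearMap.range
        (GreenGalerkin.spectralProjection (GreenGalerkin.modifiedOperator κ r n) lam ρ :
          GreenGalerkin.LInf →ₗ[ℂ] GreenGalerkin.LInf)) = 1 ∧
      ∃ lamM : ℂ,
        Metric.ball lam ρ ∩ spectrum ℂ (GreenGalerkin.modifiedOperator κ r n) = {lamM} ∧
        lamM ≠ 0 ∧
        ‖lam - lamM‖ ≤ C * (1 / (n : ℝ)) ^ (if r = 0 then 4 else 2 * r + 5) ∧
        ∀ φ ∈ LinearMap.range
            (GreenGalerkin.spectralProjection (GreenGalerkin.modifiedOperator κ r n) lam ρ :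
              GreenGalerkin.LInf →ₗ[ℂ] GreenGalerkin.LInf),
          ‖φ‖ = 1 →
          GreenGalerkin.modifiedOperator κ r n φ = lamM • φ ∧
          ‖φ - GreenGalerkin.spectralProjection κ.integralOperator lam ρ φ‖
            ≤ C * (1 / (n : ℝ)) ^ (if r = 0 then 3 else 2 * r + 3) ∧
          ‖lamM⁻¹ • κ.integralOperator φ
              - GreenGalerkin.spectralProjection κ.integralOperator lam ρ
                  (lamM⁻¹ • κ.integralOperator φ)‖
            ≤ C * (1 / (n : ℝ)) ^ (if r = 0 then 4 else 2 * r + 5) := by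
  simp only [GreenGalerkin.spectralProjection_eq_rieszProj] at hsimple ⊢
  obtain ⟨φ₀, hφ₀, h0⟩ := heig.exists_hasEigenvector
  rw [Module.End.mem_eigenspace_iff] at hφ₀
  have hφ₀' : κ.integralOperator φ₀ = lam • φ₀ := hφ₀
  obtain ⟨ε, C, hε, hC, hmain⟩ := GreenGalerkin.exists_eigen_perturbation_bounds hlam h0 hφ₀' hρ.1
    hρ.2 hsimple
  obtain ⟨Q, hQ, hD⟩ := κ.exists_norm_sub_modifiedOperator_le (by omega) r
  obtain ⟨A, hA, hφA⟩ := κ.exists_norm_eigenfunction_sub_projection_le hα hlam hφ₀'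
  have hφpos : 0 < ‖φ₀‖ := norm_pos_iff.2 h0
  set δ₀ := Q * A / ‖φ₀‖ with hδ₀
  have hδ₀0 : 0 ≤ δ₀ := by positivity
  -- Q δ₀ serves for 𝒦Dφ₀, and Q² δ₀ for ‖𝒦D‖δ.
  set η₀ := (Q + Q * Q) * δ₀ with hη₀
  -- For n ≥ Q/ε, Qh² ≤ Qh ≤ ε, which is the smallness of D required by the abstract theorem.
  obtain ⟨N, hN⟩ := exists_nat_ge (Q / ε)
  refine ⟨C * δ₀ + C * η₀, max N 1, le_max_right _ _, fun n hn => ?_⟩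
  have hn0 : 0 < n := lt_of_lt_of_le one_pos ((le_max_right N 1).trans hn)
  have hn1 : (1 : ℝ) ≤ n := by exact_mod_cast hn0
  have hh1 : 1 / (n : ℝ) ≤ 1 := by rw [div_le_one (by linarith)]; exact hn1
  have hhQ : Q * (1 / (n : ℝ)) ≤ ε := by
    have h1 : Q / ε ≤ n := hN.trans (by exact_mod_cast (le_max_left N 1).trans hn)
    rw [div_le_iff₀ hε] at h1
    rw [mul_one_div, div_le_iff₀ (by linarith)]
    linarith
  set h : ℝ := 1 / n
  have hh0 : 0 < h := by positivity
  have hsq : h ^ 2 ≤ h := by nlinarith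
  -- The order of η is that of δ, namely 2r + 3, plus the gain 1 or 2 of one more application of 𝒦.
  have he : h ^ (if r = 0 then 4 else 2 * r + 5)
      = h ^ (if r = 0 then 1 else 2) * h ^ (2 * r + 3) := by
    rw [← pow_add]
    congr 1
    split_ifs <;> omega
  have he' : h ^ (if r = 0 then 3 else 2 * r + 3) = h ^ (2 * r + 3) := by
    congr 1
    split_ifs <;> omega
  rw [he, he']
  set e := h ^ (if r = 0 then 1 else 2)
  have he0 : 0 ≤ e := by positivity
  have hφδ : ‖(κ.integralOperator - GreenGalerkin.modifiedOperator κ r n) φ₀‖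
      ≤ δ₀ * h ^ (2 * r + 3) * ‖φ₀‖ :=
    calc _ ≤ Q * h ^ 2 * ‖φ₀ - GreenGalerkin.galerkinProjection r n φ₀‖ := (hD n hn0 φ₀).1
      _ ≤ Q * h ^ 2 * (A * h ^ (2 * r + 1)) := by gcongr; exact hφA n hn0
      _ = Q * A * h ^ (2 * r + 3) := by ring
      _ = _ := by rw [hδ₀]; field_simp
  -- The factor h² of D is discarded here: ‖𝒦D‖ enters only multiplied by δ, and e δ already has the
  -- order of η.
  have hTD : ‖κ.integralOperator ∘L (κ.integralOperator - GreenGalerkin.modifiedOperator κ r n)‖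
      ≤ Q * Q * e := by
    refine ContinuousLinearMap.opNorm_le_bound _ (by positivity) fun x => ?_
    refine (hD n hn0 x).2.2.trans ?_
    calc Q * e * ‖(κ.integralOperator - GreenGalerkin.modifiedOperator κ r n) x‖
        ≤ Q * e * (Q * h ^ 2 * ‖x‖) := by gcongr; exact (hD n hn0 x).2.1
      _ ≤ Q * e * (Q * 1 * ‖x‖) := by gcongr; linarith
      _ = _ := by ring
  have hQQ : 0 ≤ Q * Q := by positivity
  obtain ⟨k1, k2, lamM, k3, k4, k5, k6⟩ := hmain (GreenGalerkin.modifiedOperator κ r n)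
    (ContinuousLinearMap.opNorm_le_bound _ hε.le fun x => (hD n hn0 x).2.1.trans (by
      gcongr
      exact le_trans (by gcongr) hhQ))
    (δ₀ * h ^ (2 * r + 3)) (η₀ * (e * h ^ (2 * r + 3))) (by positivity) hφδ
    (by
      refine (hD n hn0 φ₀).2.2.trans ?_
      calc _ ≤ Q * e * (δ₀ * h ^ (2 * r + 3) * ‖φ₀‖) := by gcongr
        _ = Q * δ₀ * (e * h ^ (2 * r + 3)) * ‖φ₀‖ := by ring
        _ ≤ _ := by
          rw [hη₀]
          gcongr
          linarith)
    (by
      calc _ ≤ Q * Q * e * (δ₀ * h ^ (2 * r + 3)) := by gcongr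
        _ = Q * Q * δ₀ * (e * h ^ (2 * r + 3)) := by ring
        _ ≤ _ := by
          rw [hη₀]
          gcongr
          linarith)
  have hη₀0 : 0 ≤ η₀ := by positivity
  have hCδ : 0 ≤ C * δ₀ := by positivity
  have hCη : 0 ≤ C * η₀ := by positivity
  refine ⟨k1, k2, lamM, k3, k4, k5.trans ?_, fun φ hφ hφ1 => ?_⟩
  · rw [← mul_assoc]
    gcongr
    linarith
  obtain ⟨m1, m2, m3⟩ := k6 φ hφ hφ1
  refine ⟨m1, m2.trans ?_, m3.trans ?_⟩
  · rw [← mul_assoc]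
    gcongr
    linarith
  · rw [← mul_assoc]
    gcongr
    linarith
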